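/- Let $V$ be a finite-dimensional complex inner product space, $\mathfrak g$ a real Lie algebra of linear operators on $V$ (for instance the image of the Lie algebra of a compact semisimple Lie group under a faithful representation), and $L\mathfrak g$ the Lie algebra of smooth loops $X:S^1=\mathbb R/2\pi\mathbb Z\to\mathfrak g$ with pointwise bracket, acting on $\mathcal H=L^2(S^1,V)$ (normalized Haar measure) by multiplication. Let $\epsilon$ be the sign operator, $\epsilon(e^{ikx}v)=e^{ikx}v$ for $k\ge 0$ and $\epsilon(e^{ikx}v)=-e^{ikx}v$ for $k<0$. For bounded operators on $\mathcal H$ put $dX=[\epsilon,X]$ and $\mathrm{Str}(Z)=\tfrac12\mathrm{Tr}(Z+\epsilon Z\epsilon)$. A flat connection is a bounded operator $B$ with $\epsilon B+B\epsilon+B^2=0$ (for instance $B=g^{-1}[\epsilon,g]$ with $g$ invertible). For $p=0,1,2,\dots$ let $$c_p(X,Y;B)=-2^{2p}\sum_{m=0}^{p}\mathrm{Str}\big(B^{2m}\,dX\,B^{2p-2m}\,Y-B^{2m}\,dY\,B^{2p-2m}\,X\big).$$ A 1-cochain is a map $\eta$ assigning to $X\in L\mathfrak g$, linearly, a smooth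 complex function $B\mapsto\eta(X;B)$ of bounded operators $B$ (in the operator norm). Its coboundary is $$(\delta\eta)(X,Y;B)=\mathcal L_X\eta(Y;B)-\mathcal L_Y\eta(X;B)-\eta([X,Y];B),\qquad \mathcal L_Xf(B)=\tfrac{d}{dt}\Big|_{t=0}f\big(e^{-tX}Be^{tX}+t\,dX\big).$$ **Theorem 4.2.** Let $p\ge 0$. For $X,Y\in L\mathfrak g$ and flat $B$, all operators whose traces occur in $c_p(X,Y;B)$ are of trace class, and so is $X\,dY$. The cocycle $$c(X,Y)=\tfrac12\mathrm{Tr}(X\,dY)=\frac{1}{2\pi i}\int_0^{2\pi}\mathrm{tr}_V\big(X(t)\,Y'(t)\big)\,dt$$ is the one defining the standard central extension of $L\mathfrak g$, and, restricted to $L\mathfrak g$, the cocycle $c_p$ is cohomologous to $2^{4p+2}\,c$: there is a 1-cochain $\eta$ such that $$c_p(X,Y;B)=2^{4p+2}\,c(X,Y)+(\delta\eta)(X,Y;B)$$ for all $X,Y\in L\mathfrak g$ and all flat $B$. In other words, the normalized cocycle $2^{-4p-2}c_p$ is cohomologous to $c$. -/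

import Mathlib

open MeasureTheory AddCircle
open scoped ContDiff ENNReal

attribute [local instance] LieRing.ofAssociativeRing

namespace FractionalLoop

noncomputable section

/-! ### Trace class operators and the trace -/

section Trace

variable {E : Type*} [NormedAddCommGroup E] [InnerProductSpace ℂ E]

/-- Trace class operators on a Hilbert space, in the nuclear form: `T = ∑ ⟪y n, ·⟫ x n` with
`∑ ‖x n‖ ‖y n‖ < ∞`. On a Hilbert space this is the Schatten class `L₁`. -/
def IsTraceClass (T : E →L[ℂ] E) : Prop :=
  ∃ x y : ℕ → E, Summable (fun n => ‖x n‖ * ‖y n‖) ∧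
    ∀ v, HasSum (fun n => inner ℂ (y n) v • x n) (T v)

/-- The trace `∑ ⟪b i, T (b i)⟫` in a Hilbert basis `b`. For trace class `T` the series converges
absolutely and its sum does not depend on the basis. -/
def opTrace [CompleteSpace E] (T : E →L[ℂ] E) : ℂ :=
  ∑' i, inner ℂ ((exists_hilbertBasis ℂ E).choose_spec.choose i)
    (T ((exists_hilbertBasis ℂ E).choose_spec.choose i))

end Trace

/-! ### The Hilbert space of the circle, the sign operator and multiplication operators -/

instance fact_two_pi_pos : Fact (0 < 2 * Real.pi) := ⟨Real.two_pi_pos⟩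

/-- The circle `S¹ = ℝ / 2πℤ`. -/
abbrev S1 : Type := AddCircle (2 * Real.pi)

section Circle

variable (V : Type*) [NormedAddCommGroup V] [InnerProductSpace ℂ V] [FiniteDimensional ℂ V]

/-- `ℋ = L²(S¹, V)`, with the normalized Haar measure `dx / 2π`. -/
abbrev HilbertS1 : Type _ := Lp V 2 (haarAddCircle : Measure S1)

/-- Bounded operators on `ℋ`. -/
abbrev Op : Type _ := HilbertS1 V →L[ℂ] HilbertS1 V

/-- The Fourier mode `x ↦ e^{ikx} v`. -/
def mode (k : ℤ) (v : V) : HilbertS1 V :=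
  ContinuousMap.toLp 2 haarAddCircle ℂ
    ⟨fun x : S1 => fourier k x • v, by fun_prop⟩

/-- `ℋ₊`, the closed span of the modes `e^{ikx} v` with `k ≥ 0`. -/
def Hplus : Submodule ℂ (HilbertS1 V) :=
  (Submodule.span ℂ {ψ | ∃ k : ℤ, 0 ≤ k ∧ ∃ v : V, ψ = mode V k v}).topologicalClosure

instance : CompleteSpace (Hplus V) :=
  inferInstanceAs (CompleteSpace (Submodule.topologicalClosure _))

/-- The sign operator `ε = D^q / |D^q|`: the identity on `ℋ₊` and minus the identity on its
orthogonal complement, so that `ε e^{ikx} = sgn(k) e^{ikx}` for `k ≠ 0` and `ε 1 = 1`. -/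
def eps : Op V := (2 : ℂ) • (Hplus V).starProjection - 1

variable {V}

/-- The multiplication operator `(M_X ψ)(x) = X(x) ψ(x)`. -/
def mulOp (X : C(S1, V →L[ℂ] V)) : Op V :=
  ContinuousLinearMap.holderL haarAddCircle ∞ 2 2 (ContinuousLinearMap.id ℂ (V →L[ℂ] V))
    (ContinuousMap.toLp ∞ haarAddCircle ℂ X)

/-! ### Differential, graded trace and flat connections -/

/-- The differential `dX = [ε, X]` on forms of degree `0`. -/
def d0 (X : Op V) : Op V := eps V * X - X * eps V

/-- The differential `dB = {ε, B}` on forms of degree `1`. -/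
def d1 (B : Op V) : Op V := eps V * B + B * eps V

/-- `Z + ε Z ε`. -/
def evenPart (Z : Op V) : Op V := Z + eps V * Z * eps V

/-- The graded trace of forms of odd degree, that is the conditional trace
`Str Z = ½ Tr (Z + ε Z ε)`. -/
def Str (Z : Op V) : ℂ := (1 / 2) * opTrace (evenPart Z)

/-- Flat connections, `dB + B² = 0`; equivalently `B = F - ε` with `F² = 1`. All operators
`g⁻¹ [ε, g]` with `g` invertible are of this kind. -/
def IsFlat (B : Op V) : Prop := d1 B + B * B = 0

/-- The form `B^{2m} dX B^{2p-2m} Y - B^{2m} dY B^{2p-2m} X`. -/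
def cocycleForm (p m : ℕ) (X Y B : Op V) : Op V :=
  B ^ (2 * m) * d0 X * B ^ (2 * (p - m)) * Y - B ^ (2 * m) * d0 Y * B ^ (2 * (p - m)) * X

/-- `c_p(X, Y; B) = - 2^{2p} ∑_{m=0}^{p} Str (B^{2m} dX B^{2p-2m} Y - B^{2m} dY B^{2p-2m} X)`. -/
def cocycle (p : ℕ) (X Y B : Op V) : ℂ :=
  -(2 : ℂ) ^ (2 * p) * ∑ m ∈ Finset.range (p + 1), Str (cocycleForm p m X Y B)

/-- `½ Tr (X dY)`. -/
def centralCocycle (X Y : Op V) : ℂ := (1 / 2) * opTrace (X * d0 Y)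

/-! ### Smooth loops, cochains and the coboundary -/

/-- The Lie algebra `L𝔤` of smooth loops in a Lie algebra `𝔤` of operators on `V`, with pointwise
bracket. -/
def smoothLoops (𝔤 : LieSubalgebra ℝ (V →L[ℂ] V)) : LieSubalgebra ℝ C(S1, V →L[ℂ] V) where
  carrier := {X | (∀ x, X x ∈ 𝔤) ∧ ContDiff ℝ ∞ fun t : ℝ => X (t : S1)}
  add_mem' := fun hX hY => ⟨fun x => 𝔤.add_mem (hX.1 x) (hY.1 x), hX.2.add hY.2⟩
  zero_mem' := ⟨fun _ => 𝔤.zero_mem, contDiff_const⟩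
  smul_mem' := fun c _ hX => ⟨fun x => 𝔤.smul_mem c (hX.1 x), contDiff_const.smul hX.2⟩
  lie_mem' := fun hX hY => ⟨fun x => 𝔤.lie_mem (hX.1 x) (hY.1 x),
    (hX.2.mul hY.2).sub (hY.2.mul hX.2)⟩

/-- The gauge derivative
`(ℒ_X f)(B) = d/dt f(e^{-tX} B e^{tX} + t dX)` at `t = 0`. -/
def gaugeDeriv (X : Op V) (f : Op V → ℂ) (B : Op V) : ℂ :=
  deriv (fun t : ℝ => f (NormedSpace.exp (-(t • X)) * B * NormedSpace.exp (t • X) + t • d0 X)) 0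

/-- `1`-cochains of `L𝔤` with values in the functions of `B`: they are linear in the loop and smooth
in `B` (for the operator norm, hence for every finer Schatten norm). -/
structure OneCochain (𝔤 : LieSubalgebra ℝ (V →L[ℂ] V)) where
  toLinearMap : smoothLoops 𝔤 →ₗ[ℝ] (Op V → ℂ)
  smooth : ∀ X, ContDiff ℝ ∞ (toLinearMap X)

/-- Palais' formula in degree one,
`(δη)(X, Y; B) = ℒ_X η(Y; B) - ℒ_Y η(X; B) - η([X, Y]; B)`. -/
def coboundary {𝔤 : LieSubalgebra ℝ (V →L[ℂ] V)} (η : OneCochain 𝔤)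
    (X Y : smoothLoops 𝔤) (B : Op V) : ℂ :=
  gaugeDeriv (mulOp X.1) (η.toLinearMap Y) B - gaugeDeriv (mulOp Y.1) (η.toLinearMap X) B
    - η.toLinearMap ⁅X, Y⁆ B

/-- Two `2`-cochains on `L𝔤`, parametrized by flat connections, are cohomologous if they differ by
the coboundary of a `1`-cochain. -/
def Cohomologous {𝔤 : LieSubalgebra ℝ (V →L[ℂ] V)}
    (c c' : smoothLoops 𝔤 → smoothLoops 𝔤 → Op V → ℂ) : Prop :=
  ∃ η : OneCochain 𝔤, ∀ (X Y : smoothLoops 𝔤) (B : Op V), IsFlat B →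
    c X Y B = c' X Y B + coboundary η X Y B

end Circle

end

end FractionalLoop

open FractionalLoop

/-! Write `φ = Tr (· dY)` and `ψ = Tr (· dX)`. For a smooth loop the matrix of `dX` in the Fourier
basis is `(sgn m - sgn n) X̂(m - n)`. It is supported where `m` and `n` have opposite signs; there
`|m - n| = |m| + |n|`, so rapid decay of `X̂` makes the matrix absolutely summable. Hence `dX` is
trace class, `φ` and `ψ` are bounded functionals, and every trace in sight obeys cyclicity. Summing
`Tr (X dY)` along diagonals `m - n = d`, the signs contribute `2d`, and Parseval turns `2d X̂(-d)
Ŷ(d)` into the integral of `tr (X Y')`.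

The rest is algebra with `S_k = ∑_{i+j=k} φ (B^{2i} X B^{2j})`. As `dY` anticommutes with `ε`, `φ`
is odd under conjugation by `ε`. Thus `φ (a X b)` depends only on `dX` when `a`, `b` both commute or
both anticommute with `ε`, and cyclicity exchanges `X` and `Y` up to a sign (`map_conj_comm`,
`map_conj_anticomm`). Flatness makes `B²` commute with `ε`, so `c_p = 2^{2p+1} S_p`, while `c = ½
S_0`.

The cochains `η_k(Y; B) = Tr (ε B^{2k+1} dY)` satisfy `δη_k = 4 S_k - S_{k+1}` (`sum_map_gauge`,
`gauge_coboundary_eq`). Weighting these by `4^{p-1-k}` and telescoping connects `S_p` to `4^p S_0`.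
-/

namespace FractionalLoop

/-! ### Nuclear operators and the trace -/

section TraceClass

variable {E : Type*} [NormedAddCommGroup E] [InnerProductSpace ℂ E]

/-- Any countable index set embeds in `ℕ`, and padding by zero changes no sum. Sums and double
series thus give nuclear representations directly. -/
theorem isTraceClass_of_hasSum {ι : Type*} [Countable ι] {T : E →L[ℂ] E} (x y : ι → E)
    (hs : Summable fun n => ‖x n‖ * ‖y n‖)
    (hT : ∀ v, HasSum (fun n => inner ℂ (y n) v • x n) (T v)) : IsTraceClass T := by
  obtain ⟨e, he⟩ := exists_injective_nat ι
  refine ⟨Function.extend e x 0, Function.extend e y 0, ?_, fun v => ?_⟩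
  · rw [← he.summable_iff]
    · refine hs.congr fun n => ?_
      simp [he.extend_apply]
    · intro k hk
      simp [Function.extend_apply' _ _ _ (by simpa using hk)]
  · rw [← he.hasSum_iff]
    · refine (hT v).congr_fun fun n => ?_
      simp [he.extend_apply]
    · intro k hk
      simp [Function.extend_apply' _ _ _ (by simpa using hk)]

theorem IsTraceClass.add {S T : E →L[ℂ] E} (hS : IsTraceClass S) (hT : IsTraceClass T) :
    IsTraceClass (S + T) := by
  obtain ⟨x, y, hs, hv⟩ := hS
  obtain ⟨x', y', hs', hv'⟩ := hT
  refine isTraceClass_of_hasSum (Sum.elim x x') (Sum.elim y y') ?_ fun v => ?_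
  · exact (HasSum.sum (f := fun n => ‖Sum.elim x x' n‖ * ‖Sum.elim y y' n‖)
      hs.hasSum hs'.hasSum).summable
  · exact HasSum.sum (f := fun n => inner ℂ (Sum.elim y y' n) v • Sum.elim x x' n)
      (hv v) (hv' v)

theorem IsTraceClass.mul_left {T : E →L[ℂ] E} (hT : IsTraceClass T) (A : E →L[ℂ] E) :
    IsTraceClass (A * T) := by
  obtain ⟨x, y, hs, hv⟩ := hT
  refine ⟨fun n => A (x n), y, ?_, fun v => ?_⟩
  · refine Summable.of_nonneg_of_le (fun n => by positivity) (fun n => ?_) (hs.mul_left ‖A‖)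
    rw [← mul_assoc]
    gcongr
    exact A.le_opNorm _
  · simpa using (hv v).mapL A

theorem IsTraceClass.neg {T : E →L[ℂ] E} (hT : IsTraceClass T) : IsTraceClass (-T) := by
  simpa using hT.mul_left (-1)

theorem IsTraceClass.sub {S T : E →L[ℂ] E} (hS : IsTraceClass S) (hT : IsTraceClass T) :
    IsTraceClass (S - T) := by
  rw [sub_eq_add_neg]
  exact hS.add hT.neg

theorem _root_.HilbertBasis.sum_norm_inner_mul_norm_inner_le {ι : Type*} (b : HilbertBasis ι ℂ E)
    (x y : E) (s : Finset ι) :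
    ∑ i ∈ s, ‖inner ℂ (b i) x‖ * ‖inner ℂ (b i) y‖ ≤ ‖x‖ * ‖y‖ := by
  refine (Real.sum_mul_le_sqrt_mul_sqrt s _ _).trans ?_
  gcongr
  · exact Real.sqrt_le_iff.2 ⟨norm_nonneg _, b.orthonormal.sum_inner_products_le x⟩
  · exact Real.sqrt_le_iff.2 ⟨norm_nonneg _, b.orthonormal.sum_inner_products_le y⟩

/-- Inserting the nuclear series gives a double series over `(n, i)`. Cauchy–Schwarz and Bessel
bound row `n` by `‖x n‖ ‖y n‖`, so the order of summation may be exchanged, and Parseval collapses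
each row. The resulting value does not involve `b`: this is the basis independence of the trace. -/
theorem hasSum_inner_apply_of_nuclear {ι : Type*} (b : HilbertBasis ι ℂ E) {T : E →L[ℂ] E}
    {x y : ℕ → E} (hs : Summable fun n => ‖x n‖ * ‖y n‖)
    (hT : ∀ v, HasSum (fun n => inner ℂ (y n) v • x n) (T v)) :
    HasSum (fun i => inner ℂ (b i) (T (b i))) (∑' n, inner ℂ (y n) (x n)) := by
  have hle := b.sum_norm_inner_mul_norm_inner_le
  have hsum : Summable fun q : ℕ × ι => inner ℂ (y q.1) (b q.2) * inner ℂ (b q.2) (x q.1) := by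
    refine Summable.of_norm ?_
    have key : Summable fun q : ℕ × ι => ‖inner ℂ (b q.2) (x q.1)‖ * ‖inner ℂ (b q.2) (y q.1)‖ := by
      rw [summable_prod_of_nonneg fun q => by positivity]
      refine ⟨fun n => summable_of_sum_le (fun i => by positivity) (hle (x n) (y n)), ?_⟩
      exact Summable.of_nonneg_of_le (fun n => tsum_nonneg fun i => by positivity)
        (fun n => Real.tsum_le_of_sum_le (fun i => by positivity) (hle (x n) (y n))) hs
    refine key.congr fun q => ?_
    rw [norm_mul, norm_inner_symm (y q.1), mul_comm]
  have h1 : HasSum (fun q : ℕ × ι => inner ℂ (y q.1) (b q.2) * inner ℂ (b q.2) (x q.1))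
      (∑' n, inner ℂ (y n) (x n)) := by
    have h := hsum.hasSum.prod_fiberwise fun n => b.hasSum_inner_mul_inner (y n) (x n)
    rw [h.tsum_eq]
    exact hsum.hasSum
  refine ((Equiv.prodComm ι ℕ).hasSum_iff.2 h1).prod_fiberwise fun i => ?_
  simpa [inner_smul_right] using (hT (b i)).mapL (innerSL ℂ (b i))

variable [CompleteSpace E]

theorem IsTraceClass.mul_right {T : E →L[ℂ] E} (hT : IsTraceClass T) (A : E →L[ℂ] E) :
    IsTraceClass (T * A) := by
  obtain ⟨x, y, hs, hv⟩ := hT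
  refine ⟨x, fun n => ContinuousLinearMap.adjoint A (y n), ?_, fun v => ?_⟩
  · refine Summable.of_nonneg_of_le (fun n => by positivity) (fun n => ?_)
      (hs.mul_left ‖ContinuousLinearMap.adjoint A‖)
    rw [mul_left_comm]
    gcongr
    exact ContinuousLinearMap.le_opNorm _ _
  · simpa [ContinuousLinearMap.adjoint_inner_left] using hv (A v)

theorem opTrace_eq_tsum_of_nuclear {T : E →L[ℂ] E}
    {x y : ℕ → E} (hs : Summable fun n => ‖x n‖ * ‖y n‖)
    (hT : ∀ v, HasSum (fun n => inner ℂ (y n) v • x n) (T v)) :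
    opTrace T = ∑' n, inner ℂ (y n) (x n) :=
  (hasSum_inner_apply_of_nuclear _ hs hT).tsum_eq

theorem IsTraceClass.hasSum_inner {ι : Type*} (b : HilbertBasis ι ℂ E) {T : E →L[ℂ] E}
    (hT : IsTraceClass T) : HasSum (fun i => inner ℂ (b i) (T (b i))) (opTrace T) := by
  obtain ⟨x, y, hs, hv⟩ := hT
  rw [opTrace_eq_tsum_of_nuclear hs hv]
  exact hasSum_inner_apply_of_nuclear b hs hv

theorem opTrace_add {S T : E →L[ℂ] E} (hS : IsTraceClass S) (hT : IsTraceClass T) :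
    opTrace (S + T) = opTrace S + opTrace T := by
  refine ((hS.add hT).hasSum_inner (exists_hilbertBasis ℂ E).choose_spec.choose).unique ?_
  simpa [inner_add_right] using (hS.hasSum_inner _).add (hT.hasSum_inner _)

theorem opTrace_neg {T : E →L[ℂ] E} (hT : IsTraceClass T) : opTrace (-T) = -opTrace T := by
  refine (hT.neg.hasSum_inner (exists_hilbertBasis ℂ E).choose_spec.choose).unique ?_
  simpa using (hT.hasSum_inner _).neg

theorem opTrace_sub {S T : E →L[ℂ] E} (hS : IsTraceClass S) (hT : IsTraceClass T) :
    opTrace (S - T) = opTrace S - opTrace T := by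
  rw [sub_eq_add_neg, opTrace_add hS hT.neg, opTrace_neg hT, sub_eq_add_neg]

/-- `A T` replaces `x n` by `A (x n)`, and `T A` replaces `y n` by the adjoint applied to `y n`;
both traces equal `∑ ⟪y n, A (x n)⟫`. -/
theorem opTrace_mul_comm {T : E →L[ℂ] E} (hT : IsTraceClass T) (A : E →L[ℂ] E) :
    opTrace (A * T) = opTrace (T * A) := by
  obtain ⟨x, y, hs, hv⟩ := hT
  have h1 : opTrace (A * T) = ∑' n, inner ℂ (y n) (A (x n)) := by
    refine opTrace_eq_tsum_of_nuclear (x := fun n => A (x n)) ?_ fun v => ?_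
    · refine Summable.of_nonneg_of_le (fun n => by positivity) (fun n => ?_) (hs.mul_left ‖A‖)
      rw [← mul_assoc]
      gcongr
      exact A.le_opNorm _
    · simpa using (hv v).mapL A
  have h2 : opTrace (T * A) = ∑' n, inner ℂ (ContinuousLinearMap.adjoint A (y n)) (x n) := by
    refine opTrace_eq_tsum_of_nuclear (y := fun n => ContinuousLinearMap.adjoint A (y n)) ?_
      fun v => ?_
    · refine Summable.of_nonneg_of_le (fun n => by positivity) (fun n => ?_)
        (hs.mul_left ‖ContinuousLinearMap.adjoint A‖)
      rw [mul_left_comm]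
      gcongr
      exact ContinuousLinearMap.le_opNorm _ _
    · simpa [ContinuousLinearMap.adjoint_inner_left] using hv (A v)
  simp_rw [h1, h2, ContinuousLinearMap.adjoint_inner_left]

theorem opTrace_smul {T : E →L[ℂ] E} (hT : IsTraceClass T) (c : ℂ) :
    opTrace (c • T) = c * opTrace T := by
  have h : IsTraceClass (c • T) := by simpa using hT.mul_left (c • 1)
  refine (h.hasSum_inner (exists_hilbertBasis ℂ E).choose_spec.choose).unique ?_
  simpa [inner_smul_right] using (hT.hasSum_inner _).mul_left c

/-- This continuity in `A` allows differentiation under the trace and yields the smoothness of the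
cochains. -/
theorem exists_opTrace_mul_bound {T : E →L[ℂ] E} (hT : IsTraceClass T) :
    ∃ C : ℝ, ∀ A : E →L[ℂ] E, ‖opTrace (A * T)‖ ≤ C * ‖A‖ := by
  obtain ⟨x, y, hs, hv⟩ := hT
  refine ⟨∑' n, ‖x n‖ * ‖y n‖, fun A => ?_⟩
  have hle : ∀ n, ‖A (x n)‖ * ‖y n‖ ≤ ‖A‖ * (‖x n‖ * ‖y n‖) := fun n => by
    rw [← mul_assoc]
    gcongr
    exact A.le_opNorm _
  have hs' : Summable fun n => ‖A (x n)‖ * ‖y n‖ :=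
    Summable.of_nonneg_of_le (fun n => by positivity) hle (hs.mul_left ‖A‖)
  have h1 : opTrace (A * T) = ∑' n, inner ℂ (y n) (A (x n)) :=
    opTrace_eq_tsum_of_nuclear (x := fun n => A (x n)) hs' fun v => by
      simpa using (hv v).mapL A
  rw [h1, mul_comm, ← tsum_mul_left]
  refine tsum_of_norm_bounded (hs.mul_left ‖A‖).hasSum fun n => ?_
  exact (norm_inner_le_norm _ _).trans (by rw [mul_comm]; exact hle n)

/-- The functional `A ↦ Tr (A T)` attached to a trace class operator `T`. -/
noncomputable def traceFunctional (T : E →L[ℂ] E) (hT : IsTraceClass T) :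
    (E →L[ℂ] E) →L[ℂ] ℂ :=
  LinearMap.mkContinuousOfExistsBound
    { toFun := fun A => opTrace (A * T)
      map_add' := fun A B => by
        rw [add_mul, opTrace_add (hT.mul_left A) (hT.mul_left B)]
      map_smul' := fun c A => by
        rw [smul_mul_assoc, opTrace_smul (hT.mul_left A)]
        rfl }
    (exists_opTrace_mul_bound hT)

theorem traceFunctional_apply {T : E →L[ℂ] E} (hT : IsTraceClass T) (A : E →L[ℂ] E) :
    traceFunctional T hT A = opTrace (A * T) := rfl

/-- An operator whose matrix in a countable Hilbert basis is absolutely summable is of trace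
class. -/
theorem isTraceClass_of_summable_matrix {ι : Type*} [Countable ι] (b : HilbertBasis ι ℂ E)
    {T : E →L[ℂ] E} (h : Summable fun q : ι × ι => ‖inner ℂ (b q.1) (T (b q.2))‖) :
    IsTraceClass T := by
  refine isTraceClass_of_hasSum (ι := ι × ι) (fun q => inner ℂ (b q.1) (T (b q.2)) • b q.1)
    (fun q => b q.2) ?_ fun v => ?_
  · refine h.congr fun q => ?_
    simp [norm_smul, b.orthonormal.1]
  · have hsum : Summable fun q : ι × ι =>
        inner ℂ (b q.2) v • inner ℂ (b q.1) (T (b q.2)) • b q.1 := by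
      refine Summable.of_norm_bounded (h.mul_left ‖v‖) fun q => ?_
      rw [norm_smul, norm_smul, b.orthonormal.1, mul_one]
      gcongr
      simpa [b.orthonormal.1] using norm_inner_le_norm (𝕜 := ℂ) (b q.2) v
    have h1 : ∀ j : ι, HasSum (fun i => inner ℂ (b j) v • inner ℂ (b i) (T (b j)) • b i)
        (inner ℂ (b j) v • T (b j)) := fun j => by
      have := (b.hasSum_repr (T (b j))).const_smul (inner ℂ (b j) v)
      simpa [b.repr_apply_apply] using this
    have h2 : HasSum (fun j => inner ℂ (b j) v • T (b j)) (T v) := by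
      have := (b.hasSum_repr v).mapL T
      simpa [b.repr_apply_apply] using this
    -- Summing over the row index first identifies the value of the absolutely convergent double
    -- series with `T v`.
    have h3 := ((Equiv.prodComm ι ι).summable_iff.2 hsum).hasSum.prod_fiberwise h1
    rw [h2.unique h3]
    exact (Equiv.prodComm ι ι).hasSum_iff.1
      ((Equiv.prodComm ι ι).summable_iff.2 hsum).hasSum

end TraceClass

/-! ### Fourier modes, the sign operator and multiplication operators -/

section Modes

variable {V : Type*} [NormedAddCommGroup V] [InnerProductSpace ℂ V] [FiniteDimensional ℂ V]

theorem coeFn_mode (k : ℤ) (v : V) :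
    mode V k v =ᵐ[haarAddCircle] fun x : S1 => fourier k x • v :=
  ContinuousMap.coeFn_toLp (E := V) (𝕜 := ℂ) (p := 2) haarAddCircle _

theorem inner_mode (k : ℤ) (v : V) (f : HilbertS1 V) :
    inner ℂ (mode V k v) f = fourierCoeff (fun x => inner ℂ v (f x)) k := by
  rw [L2.inner_def]
  refine integral_congr_ae ?_
  filter_upwards [coeFn_mode k v] with x hx
  rw [hx, inner_smul_left, fourier_neg, smul_eq_mul]

theorem inner_mode_mode (k l : ℤ) (v w : V) :
    inner ℂ (mode V k v) (mode V l w) = if k = l then inner ℂ v w else 0 := by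
  have h : (fun x => inner ℂ v (mode V l w x)) =ᵐ[haarAddCircle]
      fun x : S1 => inner ℂ v w * fourier l x := by
    filter_upwards [coeFn_mode l w] with x hx
    rw [hx, inner_smul_right, mul_comm]
  rw [inner_mode, fourierCoeff_congr_ae h, fourierCoeff.const_mul, fourierCoeff_fourier,
    Pi.single_apply]
  split_ifs <;> simp

/-- Completeness reduces to the scalar Fourier basis: each component of `f` along the orthonormal
basis of `V` is an `L²` function with vanishing Fourier coefficients. -/
theorem eq_zero_of_inner_mode_eq_zero (f : HilbertS1 V)
    (h : ∀ (k : ℤ) (a : Fin (Module.finrank ℂ V)),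
      inner ℂ (mode V k (stdOrthonormalBasis ℂ V a)) f = 0) : f = 0 := by
  have h1 : ∀ a, ∀ᵐ x ∂(haarAddCircle : Measure S1),
      inner ℂ (stdOrthonormalBasis ℂ V a) (f x) = 0 := by
    intro a
    have hg := ContinuousLinearMap.coeFn_compLp (innerSL ℂ (stdOrthonormalBasis ℂ V a)) f
    set g := (innerSL ℂ (stdOrthonormalBasis ℂ V a)).compLp f with hgdef
    have hg0 : g = 0 := by
      apply fourierBasis.repr.injective
      ext k
      rw [fourierBasis_repr, fourierCoeff_congr_ae hg, map_zero]
      exact (inner_mode k _ f).symm.trans (h k a)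
    rw [hg0] at hg
    filter_upwards [hg, Lp.coeFn_zero ℂ 2 (haarAddCircle : Measure S1)] with x hx hx0
    simpa [hx0] using hx.symm
  refine (Lp.eq_zero_iff_ae_eq_zero).2 ?_
  filter_upwards [ae_all_iff.2 h1] with x hx
  rw [← (stdOrthonormalBasis ℂ V).sum_repr' (f x)]
  simp [hx]

theorem orthonormal_modes : Orthonormal ℂ fun q : ℤ × Fin (Module.finrank ℂ V) =>
    mode V q.1 (stdOrthonormalBasis ℂ V q.2) := by
  classical
  rw [orthonormal_iff_ite]
  rintro ⟨k, a⟩ ⟨l, c⟩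
  rw [inner_mode_mode, orthonormal_iff_ite.1 (stdOrthonormalBasis ℂ V).orthonormal]
  simp only [Prod.mk.injEq, ite_and]

variable (V) in
/-- The Hilbert basis `e^{ikx} e_a` of `L²(S¹, V)`. -/
noncomputable def modeBasis :
    HilbertBasis (ℤ × Fin (Module.finrank ℂ V)) ℂ (HilbertS1 V) :=
  HilbertBasis.mkOfOrthogonalEqBot orthonormal_modes (by
    rw [Submodule.eq_bot_iff]
    intro f hf
    refine eq_zero_of_inner_mode_eq_zero f fun k a => ?_
    exact hf _ (Submodule.subset_span ⟨(k, a), rfl⟩))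

theorem modeBasis_apply (q : ℤ × Fin (Module.finrank ℂ V)) :
    modeBasis V q = mode V q.1 (stdOrthonormalBasis ℂ V q.2) := by
  rw [modeBasis, HilbertBasis.coe_mkOfOrthogonalEqBot]

/-- The eigenvalue of the sign operator on the modes `e^{ikx} v`. -/
noncomputable def modeSign (k : ℤ) : ℂ := if 0 ≤ k then 1 else -1

theorem eps_mode (k : ℤ) (v : V) : eps V (mode V k v) = modeSign k • mode V k v := by
  rw [eps, modeSign]
  split_ifs with hk
  · have hmem : mode V k v ∈ Hplus V :=
      Submodule.le_topologicalClosure _ (Submodule.subset_span ⟨k, hk, v, rfl⟩)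
    simp [Submodule.starProjection_eq_self_iff.2 hmem, two_smul]
  · have hmem : mode V k v ∈ (Hplus V)ᗮ := by
      rw [Hplus, Submodule.orthogonal_closure, Submodule.mem_orthogonal]
      intro u hu
      induction hu using Submodule.span_induction with
      | mem u hu =>
        obtain ⟨l, hl, w, rfl⟩ := hu
        rw [inner_mode_mode, if_neg (by omega)]
      | zero => simp
      | add u w _ _ hu hw => rw [inner_add_left, hu, hw, add_zero]
      | smul c u _ hu => rw [inner_smul_left, hu, mul_zero]
    simp [(Hplus V).starProjection_apply_eq_zero_iff.2 hmem]

theorem eps_mul_eps : eps V * eps V = 1 := by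
  have h : (Hplus V).starProjection * (Hplus V).starProjection = (Hplus V).starProjection :=
    (Hplus V).isIdempotentElem_starProjection
  simp only [eps, mul_sub, sub_mul, smul_mul_assoc, mul_smul_comm, h, mul_one, one_mul]
  module

theorem inner_eps_left (f g : HilbertS1 V) : inner ℂ (eps V f) g = inner ℂ f (eps V g) := by
  simp [eps, inner_sub_left, inner_sub_right, inner_smul_left, inner_smul_right,
    (Hplus V).inner_starProjection_left_eq_right, Complex.conj_ofNat]

theorem coeFn_mulOp (X : C(S1, V →L[ℂ] V)) (f : HilbertS1 V) :
    mulOp X f =ᵐ[haarAddCircle] fun x => X x (f x) := by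
  refine (ContinuousLinearMap.coeFn_holder (r := 2) (ContinuousLinearMap.id ℂ (V →L[ℂ] V))
    (ContinuousMap.toLp ∞ haarAddCircle ℂ X) f).trans ?_
  filter_upwards [ContinuousMap.coeFn_toLp (E := V →L[ℂ] V) (𝕜 := ℂ) (p := ∞) haarAddCircle X]
    with x hx
  rw [hx]
  rfl

theorem mulOp_mul (X Y : C(S1, V →L[ℂ] V)) : mulOp (X * Y) = mulOp X * mulOp Y := by
  ext1 f
  refine Lp.ext ?_
  filter_upwards [coeFn_mulOp (X * Y) f, coeFn_mulOp Y f, coeFn_mulOp X (mulOp Y f)]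
    with x h1 h2 h3
  rw [h1, mul_apply_eq_comp, h3, h2]
  rfl

theorem mulOp_add (X Y : C(S1, V →L[ℂ] V)) : mulOp (X + Y) = mulOp X + mulOp Y := by
  ext1 f
  refine Lp.ext ?_
  filter_upwards [coeFn_mulOp (X + Y) f, coeFn_mulOp X f, coeFn_mulOp Y f,
    Lp.coeFn_add (mulOp X f) (mulOp Y f)] with x h1 h2 h3 h4
  rw [h1, add_apply (mulOp X) (mulOp Y) f, h4, Pi.add_apply, h2, h3]
  rfl

theorem mulOp_sub (X Y : C(S1, V →L[ℂ] V)) : mulOp (X - Y) = mulOp X - mulOp Y := by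
  rw [eq_sub_iff_add_eq, ← mulOp_add, sub_add_cancel]

theorem mulOp_real_smul (r : ℝ) (X : C(S1, V →L[ℂ] V)) :
    mulOp (r • X) = (r : ℂ) • mulOp X := by
  ext1 f
  refine Lp.ext ?_
  filter_upwards [coeFn_mulOp (r • X) f, coeFn_mulOp X f,
    Lp.coeFn_smul (r : ℂ) (mulOp X f)] with x h1 h2 h3
  rw [h1, show ((r : ℂ) • mulOp X) f = (r : ℂ) • mulOp X f from rfl, h3, Pi.smul_apply, h2]
  simp

theorem inner_mode_mulOp_mode (X : C(S1, V →L[ℂ] V)) (m n : ℤ) (v w : V) :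
    inner ℂ (mode V m v) (mulOp X (mode V n w)) =
      fourierCoeff (fun x => inner ℂ v (X x w)) (m - n) := by
  rw [inner_mode]
  refine integral_congr_ae ?_
  filter_upwards [coeFn_mulOp X (mode V n w), coeFn_mode n w] with x h1 h2
  rw [h1, h2, map_smul, inner_smul_right, smul_eq_mul, smul_eq_mul, ← mul_assoc,
    ← fourier_add]
  congr 3
  ring

end Modes

/-! ### Fourier coefficients of smooth functions -/

section FourierDecay

theorem exists_hasDerivAt_smooth (f : C(S1, ℂ)) (hf : ContDiff ℝ ∞ fun t : ℝ => f (t : S1)) :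
    ∃ g : C(S1, ℂ), (ContDiff ℝ ∞ fun t : ℝ => g (t : S1)) ∧
      ∀ t : ℝ, HasDerivAt (fun s : ℝ => f (s : S1)) (g (t : S1)) t := by
  have hper : Function.Periodic (deriv fun s : ℝ => f (s : S1)) (2 * Real.pi) := by
    intro t
    rw [← deriv_comp_add_const]
    simp
  have hd : ContDiff ℝ ∞ (deriv fun s : ℝ => f (s : S1)) := (contDiff_infty_iff_deriv.1 hf).2
  refine ⟨⟨hper.lift, continuous_coinduced_dom.2 hd.continuous⟩, hd, fun t => ?_⟩
  exact (hf.differentiable (by simp) t).hasDerivAt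

/-- Integration by parts over one period, where the boundary terms cancel by periodicity. -/
theorem fourierCoeff_of_hasDerivAt {f g : C(S1, ℂ)}
    (h : ∀ t : ℝ, HasDerivAt (fun s : ℝ => f (s : S1)) (g (t : S1)) t) (n : ℤ) :
    fourierCoeff g n = Complex.I * n * fourierCoeff f n := by
  have hF : ∀ t : ℝ, HasDerivAt (fun s : ℝ => (fourier (-n) (s : S1) : ℂ) * f (s : S1))
      (-(Complex.I * n) * (fourier (-n) (t : S1) * f (t : S1))
        + fourier (-n) (t : S1) * g (t : S1)) t := by
    intro t
    have h1 := hasDerivAt_fourier_neg (2 * Real.pi) n t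
    have hpi : (Real.pi : ℂ) ≠ 0 := by exact_mod_cast Real.pi_ne_zero
    have hc : -2 * (Real.pi : ℂ) * Complex.I * n / ((2 * Real.pi : ℝ) : ℂ) = -(Complex.I * n) := by
      push_cast
      field_simp
    rw [hc] at h1
    have h2 := h1.mul (h t)
    rw [mul_assoc] at h2
    exact h2
  have hcont : ∀ k : C(S1, ℂ), Continuous fun t : ℝ => (fourier (-n) (t : S1) : ℂ) * k (t : S1) :=
    fun k => ((fourier (-n) * k).continuous).comp (AddCircle.continuous_mk' _)
  have hi : ∀ k : C(S1, ℂ), IntervalIntegrable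
      (fun t : ℝ => (fourier (-n) (t : S1) : ℂ) * k (t : S1)) volume 0 (0 + 2 * Real.pi) :=
    fun k => (hcont k).intervalIntegrable _ _
  have h0 := intervalIntegral.integral_eq_sub_of_hasDerivAt (fun t _ => hF t)
    (((hi f).const_mul _).add (hi g))
  rw [intervalIntegral.integral_add ((hi f).const_mul _) (hi g),
    intervalIntegral.integral_const_mul] at h0
  have hp : ((0 + 2 * Real.pi : ℝ) : S1) = ((0 : ℝ) : S1) := by
    rw [zero_add]; exact (AddCircle.coe_period _).trans (by simp)
  rw [hp, sub_self] at h0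
  rw [fourierCoeff_eq_intervalIntegral _ n 0, fourierCoeff_eq_intervalIntegral _ n 0]
  simp only [smul_eq_mul] at h0 ⊢
  rw [mul_smul_comm]
  congr 1
  linear_combination h0

theorem norm_fourierCoeff_le (f : C(S1, ℂ)) (n : ℤ) : ‖fourierCoeff f n‖ ≤ ‖f‖ := by
  have h : ∀ x : S1, ‖(fourier (-n) x : ℂ) • f x‖ ≤ ‖f‖ := fun x => by
    rw [norm_smul]
    rw [fourier_apply, Circle.norm_coe, one_mul]
    exact f.norm_coe_le_norm x
  refine (norm_integral_le_of_norm_le_const (μ := (haarAddCircle : Measure S1))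
    (Filter.Eventually.of_forall h)).trans ?_
  simp

/-- Four derivatives are taken because the decay is later split into a square in each of the two
matrix indices. The factor 8 is the convexity bound `(1 + x)⁴ ≤ 8 (1 + x⁴)`. -/
theorem exists_fourierCoeff_decay (f : C(S1, ℂ)) (hf : ContDiff ℝ ∞ fun t : ℝ => f (t : S1)) :
    ∃ C : ℝ, 0 ≤ C ∧ ∀ n : ℤ, ‖fourierCoeff f n‖ * (1 + |(n : ℝ)|) ^ 4 ≤ C := by
  obtain ⟨g₁, hg₁, h₁⟩ := exists_hasDerivAt_smooth f hf
  obtain ⟨g₂, hg₂, h₂⟩ := exists_hasDerivAt_smooth g₁ hg₁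
  obtain ⟨g₃, hg₃, h₃⟩ := exists_hasDerivAt_smooth g₂ hg₂
  obtain ⟨g₄, hg₄, h₄⟩ := exists_hasDerivAt_smooth g₃ hg₃
  refine ⟨8 * (‖f‖ + ‖g₄‖), by positivity, fun n => ?_⟩
  have e : ‖fourierCoeff g₄ n‖ = |(n : ℝ)| ^ 4 * ‖fourierCoeff f n‖ := by
    rw [fourierCoeff_of_hasDerivAt h₄, fourierCoeff_of_hasDerivAt h₃,
      fourierCoeff_of_hasDerivAt h₂, fourierCoeff_of_hasDerivAt h₁]
    simp only [norm_mul, Complex.norm_I, Complex.norm_intCast]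
    ring
  have b₀ := norm_fourierCoeff_le f n
  have b₄ := norm_fourierCoeff_le g₄ n
  rw [e] at b₄
  have hp : (1 + |(n : ℝ)|) ^ 4 ≤ 8 * (1 + |(n : ℝ)| ^ 4) := by
    nlinarith [sq_nonneg (|(n : ℝ)| - 1), sq_nonneg (|(n : ℝ)| ^ 2 - 1),
      mul_nonneg (sq_nonneg (|(n : ℝ)| - 1)) (sq_nonneg (|(n : ℝ)|)),
      mul_nonneg (sq_nonneg (|(n : ℝ)| - 1)) (abs_nonneg (n : ℝ))]
  calc ‖fourierCoeff f n‖ * (1 + |(n : ℝ)|) ^ 4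
      ≤ ‖fourierCoeff f n‖ * (8 * (1 + |(n : ℝ)| ^ 4)) := by gcongr
    _ ≤ 8 * (‖f‖ + ‖g₄‖) := by linarith

/-- Parseval for `star f` and `g`; the conjugation makes the inner product bilinear in `f` and `g`.
-/
theorem hasSum_fourierCoeff_mul (f g : C(S1, ℂ)) :
    HasSum (fun d : ℤ => fourierCoeff f (-d) * fourierCoeff g d)
      (∫ x, f x * g x ∂(haarAddCircle : Measure S1)) := by
  have h := fourierBasis.hasSum_inner_mul_inner
    (ContinuousMap.toLp (E := ℂ) 2 haarAddCircle ℂ (star f))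
    (ContinuousMap.toLp (E := ℂ) 2 (haarAddCircle : Measure S1) ℂ g)
  have hf := ContinuousMap.coeFn_toLp (E := ℂ) (𝕜 := ℂ) (p := 2)
    (haarAddCircle : Measure S1) (star f)
  have hg := ContinuousMap.coeFn_toLp (E := ℂ) (𝕜 := ℂ) (p := 2)
    (haarAddCircle : Measure S1) g
  have e1 : (fun d : ℤ => fourierCoeff f (-d) * fourierCoeff g d) = fun d =>
      inner ℂ (ContinuousMap.toLp (E := ℂ) 2 haarAddCircle ℂ (star f)) (fourierBasis d) *
        inner ℂ (fourierBasis d)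
          (ContinuousMap.toLp (E := ℂ) 2 (haarAddCircle : Measure S1) ℂ g) := by
    funext d
    congr 1
    · rw [L2.inner_def, coe_fourierBasis]
      refine integral_congr_ae ?_
      filter_upwards [hf, coeFn_fourierLp (T := 2 * Real.pi) 2 d] with x h1 h2
      rw [h1, h2]
      simp
    · rw [← fourierBasis.repr_apply_apply, fourierBasis_repr, fourierCoeff_toLp]
  have e2 : ∫ x, f x * g x ∂(haarAddCircle : Measure S1) =
      inner ℂ (ContinuousMap.toLp (E := ℂ) 2 haarAddCircle ℂ (star f))
        (ContinuousMap.toLp (E := ℂ) 2 (haarAddCircle : Measure S1) ℂ g) := by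
    rw [L2.inner_def]
    refine integral_congr_ae ?_
    filter_upwards [hf, hg] with x h1 h2
    rw [h1, h2]
    simp [mul_comm]
  rw [e1, e2]
  exact h

/-- A unit shift changes the sign only at `n = -1`, by 2; a shift by `d` is a composition of unit
shifts. -/
theorem hasSum_modeSign_sub (d : ℤ) :
    HasSum (fun n : ℤ => modeSign (n + d) - modeSign n) (2 * d) := by
  have h1 : HasSum (fun n : ℤ => modeSign (n + 1) - modeSign n) 2 := by
    have : (fun n : ℤ => modeSign (n + 1) - modeSign n) = Pi.single (-1) 2 := by
      funext n
      rw [Pi.single_apply]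
      unfold modeSign
      split_ifs <;> first | omega | norm_num
    rw [this]
    exact hasSum_pi_single _ _
  induction d using Int.induction_on with
  | zero => simp
  | succ d ih =>
    have h2 := ((Equiv.addRight (d : ℤ)).hasSum_iff.2 h1).add ih
    have e : (2 * ((d + 1 : ℤ) : ℂ)) = 2 + 2 * ((d : ℤ) : ℂ) := by push_cast; ring
    rw [e]
    refine h2.congr_fun fun n => ?_
    simp [add_assoc]
  | pred d ih =>
    have h2 := ih.sub ((Equiv.addRight (-(d : ℤ) - 1)).hasSum_iff.2 h1)
    have e : (2 * ((-d - 1 : ℤ) : ℂ)) = 2 * ((-d : ℤ) : ℂ) - 2 := by push_cast; ring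
    rw [e]
    refine h2.congr_fun fun n => ?_
    have e3 : n + (-(d : ℤ) - 1) + 1 = n + -(d : ℤ) := by ring
    simp [e3]

end FourierDecay

/-! ### Trace class commutators and the trace formula for the central cocycle -/

section LoopTrace

variable {V : Type*} [NormedAddCommGroup V] [InnerProductSpace ℂ V] [FiniteDimensional ℂ V]

/-- The matrix entry `x ↦ ⟪e_a, X(x) e_c⟫` of a loop of operators. -/
noncomputable def loopEntry (X : C(S1, V →L[ℂ] V)) (a c : Fin (Module.finrank ℂ V)) : C(S1, ℂ) :=
  ⟨fun x => inner ℂ (stdOrthonormalBasis ℂ V a) (X x (stdOrthonormalBasis ℂ V c)), by fun_prop⟩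

/-- The functional reading off a matrix entry, real linear and continuous. -/
noncomputable def entryCLM (a c : Fin (Module.finrank ℂ V)) : (V →L[ℂ] V) →L[ℝ] ℂ :=
  ((innerSL ℂ (stdOrthonormalBasis ℂ V a)).comp
    (ContinuousLinearMap.apply ℂ V (stdOrthonormalBasis ℂ V c))).restrictScalars ℝ

theorem contDiff_loopEntry {X : C(S1, V →L[ℂ] V)} (hX : ContDiff ℝ ∞ fun t : ℝ => X (t : S1))
    (a c : Fin (Module.finrank ℂ V)) : ContDiff ℝ ∞ fun t : ℝ => loopEntry X a c (t : S1) :=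
  (entryCLM a c).contDiff.comp hX

theorem inner_modeBasis_mulOp (X : C(S1, V →L[ℂ] V)) (q r : ℤ × Fin (Module.finrank ℂ V)) :
    inner ℂ (modeBasis V q) (mulOp X (modeBasis V r)) =
      fourierCoeff (loopEntry X q.2 r.2) (q.1 - r.1) := by
  rw [modeBasis_apply, modeBasis_apply, inner_mode_mulOp_mode]
  rfl

theorem inner_modeBasis_d0_mulOp (X : C(S1, V →L[ℂ] V)) (q r : ℤ × Fin (Module.finrank ℂ V)) :
    inner ℂ (modeBasis V q) (d0 (mulOp X) (modeBasis V r)) =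
      (modeSign q.1 - modeSign r.1) * fourierCoeff (loopEntry X q.2 r.2) (q.1 - r.1) := by
  have hq : eps V (modeBasis V q) = modeSign q.1 • modeBasis V q := by
    rw [modeBasis_apply, eps_mode]
  have hr : eps V (modeBasis V r) = modeSign r.1 • modeBasis V r := by
    rw [modeBasis_apply, eps_mode]
  have hc : (starRingEnd ℂ) (modeSign q.1) = modeSign q.1 := by
    unfold modeSign; split_ifs <;> simp
  have h : d0 (mulOp X) (modeBasis V r) =
      eps V (mulOp X (modeBasis V r)) - mulOp X (eps V (modeBasis V r)) := rfl
  rw [h, inner_sub_right, ← inner_eps_left, hq, hr, map_smul, inner_smul_left, inner_smul_right,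
    inner_modeBasis_mulOp, hc, sub_mul]

/-- Either the signs agree and the entry vanishes, or `|m - n| = |m| + |n|`, and then `(1 + |m|)(1 +
|n|) ≤ (1 + |m - n|)²` separates the two indices. -/
theorem norm_modeSign_sub_mul_le (m n : ℤ) {z : ℂ} {C : ℝ} (hC : 0 ≤ C)
    (h : ‖z‖ * (1 + |((m - n : ℤ) : ℝ)|) ^ 4 ≤ C) :
    ‖(modeSign m - modeSign n) * z‖ ≤
      2 * C * (((1 + |(m : ℝ)|) ^ 2)⁻¹ * ((1 + |(n : ℝ)|) ^ 2)⁻¹) := by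
  have hs : modeSign m = modeSign n ∨
      ‖modeSign m - modeSign n‖ = 2 ∧ |((m - n : ℤ) : ℝ)| = |(m : ℝ)| + |(n : ℝ)| := by
    unfold modeSign
    have key : ∀ a b : ℤ, 0 ≤ a → ¬ 0 ≤ b → |((a - b : ℤ) : ℝ)| = |(a : ℝ)| + |(b : ℝ)| := by
      intro a b ha hb
      have ha' : (0 : ℝ) ≤ a := by exact_mod_cast ha
      have hb' : (b : ℝ) < 0 := by exact_mod_cast not_le.1 hb
      push_cast
      rw [abs_of_nonneg ha', abs_of_neg hb', abs_of_nonneg (by linarith)]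
      ring
    split_ifs with h1 h2 h2
    · exact Or.inl rfl
    · exact Or.inr ⟨by norm_num, key m n h1 h2⟩
    · refine Or.inr ⟨by norm_num, ?_⟩
      have := key n m h2 h1
      rw [← neg_sub m n, Int.cast_neg, abs_neg] at this
      linarith
    · exact Or.inl rfl
  rcases hs with hs | ⟨hs, hmn⟩
  · rw [hs, sub_self, zero_mul, norm_zero]
    positivity
  · rw [norm_mul, hs, ← mul_inv, ← div_eq_mul_inv, le_div_iff₀ (by positivity)]
    have hp : (1 + |(m : ℝ)|) ^ 2 * (1 + |(n : ℝ)|) ^ 2 ≤ (1 + |((m - n : ℤ) : ℝ)|) ^ 4 := by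
      rw [hmn, ← mul_pow, show 4 = 2 * 2 from rfl, pow_mul]
      gcongr
      nlinarith [abs_nonneg (m : ℝ), abs_nonneg (n : ℝ),
        mul_nonneg (abs_nonneg (m : ℝ)) (abs_nonneg (n : ℝ))]
    nlinarith [mul_le_mul_of_nonneg_left hp (norm_nonneg z)]

theorem summable_one_add_abs_sq_inv : Summable fun n : ℤ => ((1 + |(n : ℝ)|) ^ 2)⁻¹ := by
  have h : Summable fun n : ℤ => ((n : ℝ) ^ 2)⁻¹ := by
    simpa using (Real.summable_one_div_int_pow (p := 2)).2 (by norm_num)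
  refine Summable.of_norm_bounded_eventually (g := fun n : ℤ => ((n : ℝ) ^ 2)⁻¹) h ?_
  rw [Filter.eventually_cofinite]
  refine (Set.finite_singleton (0 : ℤ)).subset fun n hn => ?_
  by_contra h0
  refine hn ?_
  have h1 : (n : ℝ) ≠ 0 := by exact_mod_cast h0
  rw [norm_inv, norm_pow, Real.norm_eq_abs, abs_of_nonneg (by positivity : 0 ≤ 1 + |(n : ℝ)|),
    ← sq_abs (n : ℝ)]
  have := abs_pos.2 h1
  gcongr
  linarith

theorem summable_matrix_d0_mulOp {X : C(S1, V →L[ℂ] V)}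
    (hX : ContDiff ℝ ∞ fun t : ℝ => X (t : S1)) :
    Summable fun q : (ℤ × Fin (Module.finrank ℂ V)) × (ℤ × Fin (Module.finrank ℂ V)) =>
      ‖inner ℂ (modeBasis V q.1) (d0 (mulOp X) (modeBasis V q.2))‖ := by
  choose C hC0 hC using fun a c => exists_fourierCoeff_decay _ (contDiff_loopEntry hX a c)
  have hG : Summable fun q : ℤ × Fin (Module.finrank ℂ V) => ((1 + |(q.1 : ℝ)|) ^ 2)⁻¹ := by
    have h := summable_one_add_abs_sq_inv.mul_of_nonneg
      (Summable.of_finite (f := fun _ : Fin (Module.finrank ℂ V) => (1 : ℝ)))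
      (fun n => by positivity) (fun _ => zero_le_one)
    simpa using h
  have hGG := hG.mul_of_nonneg hG (fun n => by positivity) (fun n => by positivity)
  refine Summable.of_nonneg_of_le (fun q => norm_nonneg _) (fun q => ?_)
    (hGG.mul_left (2 * ∑ a, ∑ c, C a c))
  rw [inner_modeBasis_d0_mulOp]
  refine norm_modeSign_sub_mul_le _ _ (Finset.sum_nonneg fun a _ => Finset.sum_nonneg
    fun c _ => hC0 a c) ((hC _ _ _).trans ?_)
  calc C q.1.2 q.2.2 ≤ ∑ c, C q.1.2 c :=
        Finset.single_le_sum (f := fun c => C q.1.2 c) (fun c _ => hC0 _ c) (Finset.mem_univ _)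
    _ ≤ ∑ a, ∑ c, C a c :=
        Finset.single_le_sum (f := fun a => ∑ c, C a c)
          (fun a _ => Finset.sum_nonneg fun c _ => hC0 a c) (Finset.mem_univ _)

theorem isTraceClass_d0_mulOp {X : C(S1, V →L[ℂ] V)}
    (hX : ContDiff ℝ ∞ fun t : ℝ => X (t : S1)) : IsTraceClass (d0 (mulOp X)) :=
  isTraceClass_of_summable_matrix (modeBasis V) (summable_matrix_d0_mulOp hX)

/-- The trace of `A T` as an absolutely convergent double sum over a Hilbert basis. -/
theorem hasSum_opTrace_mul {E ι : Type*} [NormedAddCommGroup E] [InnerProductSpace ℂ E]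
    [CompleteSpace E] [Countable ι] (b : HilbertBasis ι ℂ E) (A T : E →L[ℂ] E)
    (h : Summable fun q : ι × ι => ‖inner ℂ (b q.1) (T (b q.2))‖) :
    HasSum (fun q : ι × ι => inner ℂ (b q.1) (A (b q.2)) * inner ℂ (b q.2) (T (b q.1)))
      (opTrace (A * T)) := by
  have hs : Summable fun q : ι × ι =>
      inner ℂ (b q.1) (A (b q.2)) * inner ℂ (b q.2) (T (b q.1)) := by
    refine Summable.of_norm_bounded (((Equiv.prodComm ι ι).summable_iff.2 h).mul_left ‖A‖)
      fun q => ?_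
    rw [norm_mul]
    refine mul_le_mul_of_nonneg_right ?_ (norm_nonneg _)
    calc ‖inner ℂ (b q.1) (A (b q.2))‖ ≤ ‖b q.1‖ * ‖A (b q.2)‖ := norm_inner_le_norm _ _
      _ ≤ 1 * (‖A‖ * 1) := by
          rw [b.orthonormal.1, ← b.orthonormal.1 q.2]
          gcongr
          exact A.le_opNorm _
      _ = ‖A‖ := by ring
  have h1 : ∀ i : ι, HasSum (fun j => inner ℂ (b i) (A (b j)) * inner ℂ (b j) (T (b i)))
      (inner ℂ (b i) ((A * T) (b i))) := fun i => by
    have h2 := ((b.hasSum_repr (T (b i))).mapL A).mapL (innerSL ℂ (b i))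
    simpa [b.repr_apply_apply, inner_smul_right, mul_comm] using h2
  have h3 := hs.hasSum.prod_fiberwise h1
  rw [((isTraceClass_of_summable_matrix b h).mul_left A).hasSum_inner b |>.unique h3]
  exact hs.hasSum

theorem hasSum_opTrace_mulOp_mul_d0 (X : C(S1, V →L[ℂ] V)) {Y : C(S1, V →L[ℂ] V)}
    (hY : ContDiff ℝ ∞ fun t : ℝ => Y (t : S1)) :
    HasSum (fun q : (Fin (Module.finrank ℂ V) × Fin (Module.finrank ℂ V)) × ℤ =>
      2 * (q.2 : ℂ) * (fourierCoeff (loopEntry X q.1.1 q.1.2) (-q.2) *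
        fourierCoeff (loopEntry Y q.1.2 q.1.1) q.2))
      (opTrace (mulOp X * d0 (mulOp Y))) := by
  have h := hasSum_opTrace_mul (modeBasis V) (mulOp X) (d0 (mulOp Y)) (summable_matrix_d0_mulOp hY)
  -- Matrix entries are regrouped by diagonals: `q.1.2` is the difference of the Fourier indices and
  -- `q.2` runs along the diagonal, so that only the signs vary in the inner sum.
  let e : ((Fin (Module.finrank ℂ V) × Fin (Module.finrank ℂ V)) × ℤ) × ℤ ≃
      (ℤ × Fin (Module.finrank ℂ V)) × (ℤ × Fin (Module.finrank ℂ V)) :=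
    { toFun := fun q => ((q.2, q.1.1.1), (q.2 + q.1.2, q.1.1.2))
      invFun := fun r => (((r.1.2, r.2.2), r.2.1 - r.1.1), r.1.1)
      left_inv := fun q => by simp
      right_inv := fun r => by simp }
  refine (e.hasSum_iff.2 h).prod_fiberwise fun q => ?_
  have h1 := (hasSum_modeSign_sub q.2).mul_right
    (fourierCoeff (loopEntry X q.1.1 q.1.2) (-q.2) * fourierCoeff (loopEntry Y q.1.2 q.1.1) q.2)
  refine h1.congr_fun fun n => ?_
  simp only [e, Function.comp_apply, Equiv.coe_fn_mk, inner_modeBasis_mulOp,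
    inner_modeBasis_d0_mulOp]
  rw [show n - (n + q.2) = -q.2 by ring, show n + q.2 - n = q.2 by ring]
  ring

theorem hasDerivAt_loopEntry {Y : C(S1, V →L[ℂ] V)}
    (hY : ContDiff ℝ ∞ fun t : ℝ => Y (t : S1)) (a c : Fin (Module.finrank ℂ V)) (t : ℝ) :
    HasDerivAt (fun s : ℝ => loopEntry Y a c (s : S1))
      (entryCLM a c (deriv (fun s : ℝ => Y (s : S1)) t)) t :=
  (entryCLM a c).hasFDerivAt.comp_hasDerivAt t
    (hY.differentiable (by simp) t).hasDerivAt

/-- The factor `d` in the diagonal sum is absorbed by `d Ŷ(d) = (Y')^(d) / i`; Parseval for each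
pair of matrix entries then assembles the pointwise trace of `X Y'`. -/
theorem opTrace_mulOp_mul_d0 (X : C(S1, V →L[ℂ] V)) {Y : C(S1, V →L[ℂ] V)}
    (hY : ContDiff ℝ ∞ fun t : ℝ => Y (t : S1)) :
    (1 / 2) * opTrace (mulOp X * d0 (mulOp Y)) =
      (2 * Real.pi * Complex.I)⁻¹ * ∫ t in (0 : ℝ)..(2 * Real.pi),
        LinearMap.trace ℂ V (X (t : S1) * deriv (fun s : ℝ => Y (s : S1)) t : V →L[ℂ] V) := by
  choose g hg hgd using fun a c => exists_hasDerivAt_smooth _ (contDiff_loopEntry hY a c)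
  have hsum := hasSum_opTrace_mulOp_mul_d0 X hY
  have hfib : ∀ r : Fin (Module.finrank ℂ V) × Fin (Module.finrank ℂ V),
      HasSum (fun d : ℤ => 2 * (d : ℂ) * (fourierCoeff (loopEntry X r.1 r.2) (-d) *
        fourierCoeff (loopEntry Y r.2 r.1) d))
      (2 / Complex.I * ∫ x, loopEntry X r.1 r.2 x * g r.2 r.1 x ∂(haarAddCircle : Measure S1)) := by
    intro r
    refine ((hasSum_fourierCoeff_mul (loopEntry X r.1 r.2) (g r.2 r.1)).mul_left
      (2 / Complex.I)).congr_fun fun d => ?_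
    rw [fourierCoeff_of_hasDerivAt (hgd r.2 r.1)]
    field_simp
  have htr := (hsum.prod_fiberwise hfib).unique (hasSum_fintype _)
  have hint : ∀ k : C(S1, ℂ), ∫ x, k x ∂(haarAddCircle : Measure S1) =
      (2 * Real.pi : ℂ)⁻¹ * ∫ t in (0 : ℝ)..(2 * Real.pi), k (t : S1) := by
    intro k
    have h := fourierCoeff_eq_intervalIntegral k 0 0
    simp only [fourierCoeff, neg_zero, fourier_zero, one_smul, zero_add] at h
    rw [h, Complex.real_smul]
    push_cast
    rw [one_div]
  have hpt : ∀ t : ℝ, LinearMap.trace ℂ V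
      (X (t : S1) * deriv (fun s : ℝ => Y (s : S1)) t : V →L[ℂ] V) =
      ∑ r : Fin (Module.finrank ℂ V) × Fin (Module.finrank ℂ V),
        (loopEntry X r.1 r.2 * g r.2 r.1) (t : S1) := by
    intro t
    rw [LinearMap.trace_eq_sum_inner _ (stdOrthonormalBasis ℂ V), Fintype.sum_prod_type]
    refine Finset.sum_congr rfl fun a _ => ?_
    have hg' : ∀ c, g c a (t : S1) = inner ℂ (stdOrthonormalBasis ℂ V c)
        (deriv (fun s : ℝ => Y (s : S1)) t (stdOrthonormalBasis ℂ V a)) := fun c =>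
      (hgd c a t).unique (hasDerivAt_loopEntry hY c a t)
    have hexp := (stdOrthonormalBasis ℂ V).sum_repr'
      (deriv (fun s : ℝ => Y (s : S1)) t (stdOrthonormalBasis ℂ V a))
    change inner ℂ _ (X (t : S1) (deriv (fun s : ℝ => Y (s : S1)) t
      (stdOrthonormalBasis ℂ V a))) = _
    conv_lhs => rw [← hexp]
    rw [map_sum, inner_sum]
    refine Finset.sum_congr rfl fun c _ => ?_
    rw [map_smul, inner_smul_right, ContinuousMap.mul_apply, hg', mul_comm]
    rfl
  simp_rw [hpt]
  rw [intervalIntegral.integral_finsetSum fun r _ =>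
    ((map_continuous (loopEntry X r.1 r.2 * g r.2 r.1)).comp
      (AddCircle.continuous_mk' _)).intervalIntegrable _ _, htr, Finset.mul_sum, Finset.mul_sum]
  refine Finset.sum_congr rfl fun r _ => ?_
  have h := hint (loopEntry X r.1 r.2 * g r.2 r.1)
  simp only [ContinuousMap.mul_apply] at h ⊢
  rw [h]
  have hpi : (Real.pi : ℂ) ≠ 0 := by exact_mod_cast Real.pi_ne_zero
  field_simp

end LoopTrace

/-! ### Algebra of flat connections and functionals odd under the sign -/

section FlatAlgebra

theorem sum_range_two_mul_add_one {M : Type*} [AddCommMonoid M] (f : ℕ → M) (k : ℕ) :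
    ∑ j ∈ Finset.range (2 * k + 1), f j =
      ∑ i ∈ Finset.range (k + 1), f (2 * i) + ∑ i ∈ Finset.range k, f (2 * i + 1) := by
  induction k with
  | zero => simp
  | succ k ih =>
    rw [show 2 * (k + 1) + 1 = 2 * k + 1 + 1 + 1 by ring, Finset.sum_range_succ f,
      Finset.sum_range_succ f, ih, Finset.sum_range_succ (fun i => f (2 * i)) (k + 1),
      Finset.sum_range_succ (fun i => f (2 * i + 1)) k, show 2 * (k + 1) = 2 * k + 1 + 1 by ring]
    abel

variable {A : Type*} [Ring A] {e B : A}

/-- By flatness `B²` is minus the anticommutator of `B` with the involution `e`, and such an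
anticommutator commutes with `e`. -/
theorem sign_mul_sq_comm (he : e * e = 1) (hB : e * B + B * e + B * B = 0) :
    Commute e (B * B) := by
  change e * (B * B) = B * B * e
  have h : B * B = -(e * B + B * e) := by
    rw [eq_neg_iff_add_eq_zero, add_comm]; exact hB
  rw [h]
  simp only [mul_neg, neg_mul, mul_add, add_mul, ← mul_assoc, he, one_mul]
  simp only [mul_assoc, he, mul_one]
  abel

variable [Algebra ℂ A]

/-- In the first half of the commutator the leading `e` passes `P` and meets `e + B`. In the second
half oddness of `φ` carries it to the right end with a sign, where it passes `Q` and meets `e + B`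
from the other side. -/
theorem map_sign_even_gauge (φ : A →ₗ[ℂ] ℂ) (he : e * e = 1)
    (hφ : ∀ a, φ (e * a * e) = -φ a) (X : A) {P Q : A} (hP : e * P = P * e) (hQ : e * Q = Q * e) :
    φ (e * P * ((e + B) * X - X * (e + B)) * Q) =
      2 * φ (P * X * Q) + φ (P * (e * B) * X * Q) + φ (P * X * (B * e) * Q) := by
  have h1 : e * P * ((e + B) * X - X * (e + B)) * Q =
      P * X * Q + P * (e * B) * X * Q - e * (P * X * (e + B) * Q) := by
    have : e * P * ((e + B) * X) * Q = P * (e * e) * X * Q + P * (e * B) * X * Q := by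
      rw [hP]; noncomm_ring
    rw [mul_sub, sub_mul, this, he, mul_one]
    simp only [mul_assoc]
  have h2 : φ (e * (P * X * (e + B) * Q)) = -(φ (P * X * Q) + φ (P * X * (B * e) * Q)) := by
    rw [← neg_eq_iff_eq_neg, ← hφ, ← map_add]
    congr 1
    have : e * (e * (P * X * (e + B) * Q)) * e = (e * e) * (P * X * (e + B) * (Q * e)) := by
      noncomm_ring
    rw [this, ← hQ, he, one_mul]
    have : P * X * (e + B) * (e * Q) = P * X * (e * e) * Q + P * X * (B * e) * Q := by
      noncomm_ring
    rw [this, he, mul_one]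
  rw [h1, map_sub, map_add, h2]
  ring

/-- Flatness gives `B (e + B) = -e B` and `(e + B) B = -B e`, which removes `e + B`; oddness of `φ`
shows that the two resulting words contribute equally. -/
theorem map_sign_odd_gauge (φ : A →ₗ[ℂ] ℂ) (he : e * e = 1)
    (hB : e * B + B * e + B * B = 0)
    (hφ : ∀ a, φ (e * a * e) = -φ a) (X : A) {P Q : A} (hP : e * P = P * e) (hQ : e * Q = Q * e) :
    φ (e * (P * B) * ((e + B) * X - X * (e + B)) * (B * Q)) =
      2 * φ (P * (e * B) * X * (B * e) * Q) := by
  have hBF : B * (e + B) = -(e * B) := by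
    rw [eq_neg_iff_add_eq_zero, ← hB]; noncomm_ring
  have hFB : (e + B) * B = -(B * e) := by
    rw [eq_neg_iff_add_eq_zero, ← hB]; noncomm_ring
  have h1 : e * (P * B) * ((e + B) * X - X * (e + B)) * (B * Q) =
      -(P * B * X * B * Q) + P * (e * B) * X * (B * e) * Q := by
    have : e * (P * B) * ((e + B) * X - X * (e + B)) * (B * Q) =
        e * P * (B * (e + B)) * X * B * Q - e * P * B * X * ((e + B) * B) * Q := by
      noncomm_ring
    rw [this, hBF, hFB, hP]
    have : P * e * -(e * B) * X * B * Q = -(P * (e * e) * B * X * B * Q) := by noncomm_ring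
    rw [this, he]
    noncomm_ring
  have h2 : -φ (P * B * X * B * Q) = φ (P * (e * B) * X * (B * e) * Q) := by
    rw [← hφ]
    congr 1
    have : e * (P * B * X * B * Q) * e = (e * P) * B * X * B * (Q * e) := by noncomm_ring
    rw [this, hP, ← hQ]
    noncomm_ring
  rw [h1, map_add, map_neg, h2]
  ring

/-- Averaging `a X b` with minus its conjugate by `e` replaces `X` by its commutator with `e`, the
form in which cyclicity of the trace applies. -/
theorem map_two_mul_eq_neg (φ : A →ₗ[ℂ] ℂ) (hφ : ∀ a, φ (e * a * e) = -φ a) {X a b : A}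
    (hab : e * (a * X * b) * e = a * (e * X * e) * b) (he : e * e = 1) :
    2 * φ (a * X * b) = -φ (a * (e * X - X * e) * (e * b)) := by
  have h1 : a * (e * X - X * e) * (e * b) = a * (e * X * e) * b - a * X * (e * e) * b := by
    noncomm_ring
  have h2 := hφ (a * X * b)
  rw [hab] at h2
  rw [h1, he, mul_one, map_sub, h2]
  ring

variable {X Y : A} {φ ψ : A →ₗ[ℂ] ℂ}

/-- Both sides are rewritten through commutators by `map_two_mul_eq_neg` and matched by `h`; the
sign comes from moving `e` past the commutator `e * Y - Y * e`, with which it anticommutes. -/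
theorem map_conj_comm (he : e * e = 1) (hφ : ∀ a, φ (e * a * e) = -φ a)
    (hψ : ∀ a, ψ (e * a * e) = -ψ a)
    (h : ∀ a c, φ (a * (e * X - X * e) * c) = ψ (c * (e * Y - Y * e) * a))
    {a b : A} (ha : e * a = a * e) (hb : e * b = b * e) :
    φ (a * X * b) = -ψ (b * Y * a) := by
  have conj : ∀ {a b : A} (Z : A), e * a = a * e → e * b = b * e →
      e * (a * Z * b) * e = a * (e * Z * e) * b := by
    intro a b Z ha hb
    calc e * (a * Z * b) * e = (e * a) * Z * (b * e) := by noncomm_ring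
      _ = a * (e * Z * e) * b := by rw [ha, ← hb]; noncomm_ring
  have h1 := map_two_mul_eq_neg φ hφ (conj X ha hb) he
  have h2 := map_two_mul_eq_neg ψ hψ (conj Y hb ha) he
  have h3 : e * b * (e * Y - Y * e) * a = -(b * (e * Y - Y * e) * (e * a)) := by
    rw [hb]
    have : b * e * (e * Y - Y * e) * a + b * (e * Y - Y * e) * (e * a) =
      b * (e * e) * Y * a - b * Y * (e * e) * a := by noncomm_ring
    rw [eq_neg_iff_add_eq_zero, this, he]
    simp
  rw [h, h3, map_neg] at h1
  linear_combination (1 / 2) * h1 + (1 / 2) * h2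

/-- Moving `e` past `b` as well costs a second sign, so here the exchange is symmetric. -/
theorem map_conj_anticomm (he : e * e = 1) (hφ : ∀ a, φ (e * a * e) = -φ a)
    (hψ : ∀ a, ψ (e * a * e) = -ψ a)
    (h : ∀ a c, φ (a * (e * X - X * e) * c) = ψ (c * (e * Y - Y * e) * a))
    {a b : A} (ha : e * a = -(a * e)) (hb : e * b = -(b * e)) :
    φ (a * X * b) = ψ (b * Y * a) := by
  have conj : ∀ {a b : A} (Z : A), e * a = -(a * e) → e * b = -(b * e) →
      e * (a * Z * b) * e = a * (e * Z * e) * b := by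
    intro a b Z ha hb
    calc e * (a * Z * b) * e = (e * a) * Z * (b * e) := by noncomm_ring
      _ = a * (e * Z * e) * b := by rw [ha, ← neg_eq_iff_eq_neg.2 hb]; noncomm_ring
  have h1 := map_two_mul_eq_neg φ hφ (conj X ha hb) he
  have h2 := map_two_mul_eq_neg ψ hψ (conj Y hb ha) he
  have h3 : e * b * (e * Y - Y * e) * a = b * (e * Y - Y * e) * (e * a) := by
    rw [hb]
    have : -(b * e) * (e * Y - Y * e) * a - b * (e * Y - Y * e) * (e * a) =
      b * Y * (e * e) * a - b * (e * e) * Y * a := by noncomm_ring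
    rw [← sub_eq_zero, this, he]
    simp
  rw [h, h3] at h1
  linear_combination (1 / 2) * h1 - (1 / 2) * h2

/-- `½ [ε, B]`, the part of `εB` that anticommutes with `ε`. -/
noncomputable def signSkew (e B : A) : A := (1 / 2 : ℂ) • (e * B - B * e)

/-- `∑_{i+j=k} φ (B^{2i} X B^{2j})`. -/
noncomputable def evenSum (φ : A →ₗ[ℂ] ℂ) (B X : A) (k : ℕ) : ℂ :=
  ∑ i ∈ Finset.range (k + 1), φ ((B * B) ^ i * X * (B * B) ^ (k - i))

/-- The splitting of `e B` into half a commutator and half an anticommutator, the latter being `-B²`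
by flatness. -/
theorem sign_mul_eq_signSkew (hB : e * B + B * e + B * B = 0) :
    e * B = signSkew e B - (1 / 2 : ℂ) • (B * B) := by
  have h : B * B = -(e * B + B * e) := by
    rw [eq_neg_iff_add_eq_zero, add_comm]; exact hB
  rw [h, signSkew]
  module

theorem mul_sign_eq_signSkew (hB : e * B + B * e + B * B = 0) :
    B * e = -signSkew e B - (1 / 2 : ℂ) • (B * B) := by
  have h : B * B = -(e * B + B * e) := by
    rw [eq_neg_iff_add_eq_zero, add_comm]; exact hB
  rw [h, signSkew]
  module

theorem sign_mul_signSkew (he : e * e = 1) : e * signSkew e B = -(signSkew e B * e) := by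
  have h : e * (e * B - B * e) = -((e * B - B * e) * e) := by
    have : e * (e * B - B * e) + (e * B - B * e) * e = (e * e) * B - B * (e * e) := by
      noncomm_ring
    rw [eq_neg_iff_add_eq_zero, this, he]
    simp
  rw [signSkew, mul_smul_comm, smul_mul_assoc, h, smul_neg]

theorem signSkew_comm_sq (he : e * e = 1) (hB : e * B + B * e + B * B = 0) :
    Commute (signSkew e B) (B * B) := by
  have h1 : Commute (e * B - B * e) (B * B) := by
    have h2 : Commute e (B * B) := sign_mul_sq_comm he hB
    have h3 : Commute B (B * B) := (mul_assoc B B B).symm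
    exact (h2.mul_left h3).sub_left (h3.mul_left h2)
  exact h1.smul_left _

/-- The derivative of `ε B^{2k+1}` in the direction `[ε + B, X]`, evaluated by a functional that is
odd under conjugation by `ε`. -/
theorem sum_map_gauge (he : e * e = 1) (hB : e * B + B * e + B * B = 0)
    (hφ : ∀ a, φ (e * a * e) = -φ a) (X : A) (k : ℕ) :
    ∑ j ∈ Finset.range (2 * k + 1),
        φ (e * B ^ j * ((e + B) * X - X * (e + B)) * B ^ (2 * k - j)) =
      2 * evenSum φ B X k - (1 / 2) * evenSum φ B X (k + 1)
        - 2 * ∑ i ∈ Finset.range k,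
          φ ((B * B) ^ i * signSkew e B * X * (signSkew e B * (B * B) ^ (k - 1 - i)))
        + φ ((B * B) ^ k * signSkew e B * X) - φ (X * (signSkew e B * (B * B) ^ k)) := by
  set N := B * B with hN
  set w := signSkew e B with hw
  have hcomm : ∀ i, e * N ^ i = N ^ i * e := fun i =>
    (sign_mul_sq_comm he hB).pow_right i
  have heB : e * B = w - (1 / 2 : ℂ) • N := sign_mul_eq_signSkew hB
  have hBe : B * e = -w - (1 / 2 : ℂ) • N := mul_sign_eq_signSkew hB
  have hpow : ∀ i, B ^ (2 * i) = N ^ i := fun i => by rw [pow_mul, sq]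
  have hE : ∀ i j, φ (e * N ^ i * ((e + B) * X - X * (e + B)) * N ^ j) =
      2 * φ (N ^ i * X * N ^ j) + φ (N ^ i * w * X * N ^ j)
        - (1 / 2) * φ (N ^ (i + 1) * X * N ^ j) - φ (N ^ i * X * (w * N ^ j))
        - (1 / 2) * φ (N ^ i * X * N ^ (j + 1)) := by
    intro i j
    rw [map_sign_even_gauge φ he hφ X (hcomm i) (hcomm j), heB, hBe]
    simp only [mul_sub, sub_mul, mul_neg, neg_mul, mul_smul_comm, smul_mul_assoc, map_sub, map_neg,
      map_smul, smul_eq_mul, pow_succ N i, pow_succ' N j, mul_assoc]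
    ring
  have hO : ∀ i j, φ (e * (N ^ i * B) * ((e + B) * X - X * (e + B)) * (B * N ^ j)) =
      -2 * φ (N ^ i * w * X * (w * N ^ j)) - φ (N ^ i * w * X * N ^ (j + 1))
        + φ (N ^ (i + 1) * X * (w * N ^ j)) + (1 / 2) * φ (N ^ (i + 1) * X * N ^ (j + 1)) := by
    intro i j
    rw [map_sign_odd_gauge φ he hB hφ X (hcomm i) (hcomm j), heB, hBe]
    simp only [mul_sub, sub_mul, mul_neg, neg_mul, mul_smul_comm, smul_mul_assoc, map_sub, map_neg,
      map_smul, smul_eq_mul, pow_succ N i, pow_succ' N j, mul_assoc]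
    ring
  have hE' : ∀ i ∈ Finset.range (k + 1),
      φ (e * B ^ (2 * i) * ((e + B) * X - X * (e + B)) * B ^ (2 * k - 2 * i)) =
      2 * φ (N ^ i * X * N ^ (k - i)) + φ (N ^ i * w * X * N ^ (k - i))
        - (1 / 2) * φ (N ^ (i + 1) * X * N ^ (k - i)) - φ (N ^ i * X * (w * N ^ (k - i)))
        - (1 / 2) * φ (N ^ i * X * N ^ (k - i + 1)) := by
    intro i _
    rw [← Nat.mul_sub, hpow, hpow, hE]
  have hO' : ∀ i ∈ Finset.range k,
      φ (e * B ^ (2 * i + 1) * ((e + B) * X - X * (e + B)) * B ^ (2 * k - (2 * i + 1))) =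
      -2 * φ (N ^ i * w * X * (w * N ^ (k - 1 - i))) - φ (N ^ i * w * X * N ^ (k - i))
        + φ (N ^ (i + 1) * X * (w * N ^ (k - (i + 1))))
        + (1 / 2) * φ (N ^ (i + 1) * X * N ^ (k + 1 - (i + 1))) := by
    intro i hi
    have hi' := Finset.mem_range.1 hi
    have h1 : 2 * k - (2 * i + 1) = 2 * (k - 1 - i) + 1 := by omega
    rw [h1, pow_succ, pow_succ', hpow, hpow, hO]
    have h2 : k - 1 - i + 1 = k - i := by omega
    have h3 : k - (i + 1) = k - 1 - i := by omega
    have h4 : k + 1 - (i + 1) = k - i := by omega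
    rw [h2, h3, h4]
  rw [sum_range_two_mul_add_one, Finset.sum_congr rfl hE', Finset.sum_congr rfl hO']
  simp only [Finset.sum_add_distrib, Finset.sum_sub_distrib, ← Finset.mul_sum]
  -- The words with a single `w` from even and odd `j` cancel except at the two ends, which are
  -- split off here.
  have s1 : ∑ i ∈ Finset.range (k + 1), φ (N ^ i * w * X * N ^ (k - i)) =
      ∑ i ∈ Finset.range k, φ (N ^ i * w * X * N ^ (k - i)) + φ (N ^ k * w * X) := by
    rw [Finset.sum_range_succ]; simp
  have s2 : ∑ i ∈ Finset.range (k + 1), φ (N ^ i * X * (w * N ^ (k - i))) =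
      ∑ i ∈ Finset.range k, φ (N ^ (i + 1) * X * (w * N ^ (k - (i + 1))))
        + φ (X * (w * N ^ k)) := by
    rw [Finset.sum_range_succ']; simp
  have s3 : evenSum φ B X (k + 1) =
      ∑ i ∈ Finset.range (k + 1), φ (N ^ (i + 1) * X * N ^ (k - i)) + φ (X * N ^ (k + 1)) := by
    rw [evenSum, Finset.sum_range_succ']; simp [N]
  have s4 : evenSum φ B X (k + 1) =
      ∑ i ∈ Finset.range (k + 1), φ (N ^ i * X * N ^ (k - i + 1)) + φ (N ^ (k + 1) * X) := by
    rw [evenSum, Finset.sum_range_succ]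
    congr 1
    · refine Finset.sum_congr rfl fun i hi => ?_
      have hi' := Finset.mem_range.1 hi
      rw [show k + 1 - i = k - i + 1 by omega]
    · simp [N]
  have s5 : evenSum φ B X (k + 1) =
      ∑ i ∈ Finset.range k, φ (N ^ (i + 1) * X * N ^ (k + 1 - (i + 1))) + φ (N ^ (k + 1) * X)
        + φ (X * N ^ (k + 1)) := by
    rw [evenSum, Finset.sum_range_succ', Finset.sum_range_succ]; simp [N]
  have s6 : evenSum φ B X k = ∑ i ∈ Finset.range (k + 1), φ (N ^ i * X * N ^ (k - i)) := rfl
  rw [s1, s2, s6]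
  -- Even `j` give two copies of `S_{k+1}` with weight `-½`, each missing one end word; odd `j` give
  -- one copy with weight `+½` missing both. The end words cancel and `-½ S_{k+1}` remains.
  linear_combination (1 / 2) * s3 + (1 / 2) * s4 - (1 / 2) * s5

/-- The algebraic form of `δ η_k = 4 S_k - S_{k+1}` for the functionals `φ = Tr (· dY)` and
`ψ = Tr (· dX)`. -/
theorem gauge_coboundary_eq (he : e * e = 1) (hB : e * B + B * e + B * B = 0)
    (hφ : ∀ a, φ (e * a * e) = -φ a) (hψ : ∀ a, ψ (e * a * e) = -ψ a)
    (h : ∀ a c, φ (a * (e * X - X * e) * c) = ψ (c * (e * Y - Y * e) * a)) (k : ℕ) :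
    ∑ j ∈ Finset.range (2 * k + 1),
        φ (e * B ^ j * ((e + B) * X - X * (e + B)) * B ^ (2 * k - j))
      - ∑ j ∈ Finset.range (2 * k + 1),
        ψ (e * B ^ j * ((e + B) * Y - Y * (e + B)) * B ^ (2 * k - j))
      - (ψ (Y * (e * B ^ (2 * k + 1))) + φ (e * B ^ (2 * k + 1) * X)
        - φ (X * (e * B ^ (2 * k + 1))) - ψ (e * B ^ (2 * k + 1) * Y)) =
      4 * evenSum φ B X k - evenSum φ B X (k + 1) := by
  rw [sum_map_gauge he hB hφ, sum_map_gauge he hB hψ]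
  have hcomm : ∀ i, e * (B * B) ^ i = (B * B) ^ i * e := fun i =>
    (sign_mul_sq_comm he hB).pow_right i
  have hwN : ∀ i, signSkew e B * (B * B) ^ i = (B * B) ^ i * signSkew e B := fun i =>
    ((signSkew_comm_sq he hB).pow_right i)
  have hew := sign_mul_signSkew (B := B) he
  -- The even sums are antisymmetric under exchange of `X` and `Y`, so the difference doubles them.
  have hsum : ∀ k, evenSum ψ B Y k = -evenSum φ B X k := by
    intro k
    rw [evenSum, evenSum, ← Finset.sum_range_reflect, ← Finset.sum_neg_distrib]
    refine Finset.sum_congr rfl fun i hi => ?_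
    have hi' := Finset.mem_range.1 hi
    rw [map_conj_comm he hφ hψ h (hcomm i) (hcomm (k - i)), neg_neg,
      show k + 1 - 1 - i = k - i by omega, show k - (k - i) = i by omega]
  have hskew : ∀ i, e * ((B * B) ^ i * signSkew e B) = -((B * B) ^ i * signSkew e B * e) := by
    intro i
    rw [← mul_assoc, hcomm, mul_assoc, hew, mul_neg, mul_assoc]
  -- The words with two factors `w` are symmetric under the exchange, hence drop out of the
  -- difference.
  have hww : ∑ i ∈ Finset.range k,
        ψ ((B * B) ^ i * signSkew e B * Y * (signSkew e B * (B * B) ^ (k - 1 - i))) =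
      ∑ i ∈ Finset.range k,
        φ ((B * B) ^ i * signSkew e B * X * (signSkew e B * (B * B) ^ (k - 1 - i))) := by
    rw [← Finset.sum_range_reflect]
    refine Finset.sum_congr rfl fun i hi => ?_
    have hi' := Finset.mem_range.1 hi
    rw [hwN, hwN, map_conj_anticomm he hφ hψ h (hskew i) (hskew (k - 1 - i)),
      show k - 1 - (k - 1 - i) = i by omega]
  have hC : e * B ^ (2 * k + 1) =
      (B * B) ^ k * signSkew e B - (1 / 2 : ℂ) • (B * B) ^ (k + 1) := by
    have : e * B ^ (2 * k + 1) = (B * B) ^ k * (e * B) := by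
      rw [pow_succ, pow_mul, sq, ← mul_assoc, hcomm, mul_assoc]
    rw [this, sign_mul_eq_signSkew hB, mul_sub, mul_smul_comm, pow_succ]
  -- The `B^{2k+2}` part of `ε B^{2k+1}` contributes nothing to the bracket term, by `c1` and `c2`;
  -- its `w` part cancels the end words of `sum_map_gauge`.
  have c1 : φ ((B * B) ^ (k + 1) * X) = -ψ (Y * (B * B) ^ (k + 1)) := by
    simpa using map_conj_comm (b := 1) he hφ hψ h (hcomm (k + 1)) (by simp)
  have c2 : φ (X * (B * B) ^ (k + 1)) = -ψ ((B * B) ^ (k + 1) * Y) := by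
    simpa using map_conj_comm (a := 1) he hφ hψ h (by simp) (hcomm (k + 1))
  rw [hC, hsum, hsum, hww, hwN]
  simp only [mul_sub, sub_mul, mul_smul_comm, smul_mul_assoc, map_sub, map_smul, smul_eq_mul]
  linear_combination (1 / 2) * c1 - (1 / 2) * c2

end FlatAlgebra

/-! ### Gauge derivatives, the cochains and their coboundary -/

section Cohomology

theorem real_smul_op {V : Type*} [NormedAddCommGroup V] [InnerProductSpace ℂ V] (t : ℝ) (X : Op V) : t • X = (t : ℂ) • X := by
  ext1 f
  exact (RCLike.real_smul_eq_coe_smul (K := ℂ) t (X f))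

variable {V : Type*} [NormedAddCommGroup V] [InnerProductSpace ℂ V] [FiniteDimensional ℂ V]

theorem eps_mul_d0 (X : Op V) : eps V * d0 X = -(d0 X * eps V) := by
  have h : eps V * d0 X + d0 X * eps V = eps V * eps V * X - X * (eps V * eps V) := by
    rw [d0]; noncomm_ring
  rw [eq_neg_iff_add_eq_zero, h, eps_mul_eps]
  simp

theorem d0_mul (X Y : Op V) : d0 (X * Y) = d0 X * Y + X * d0 Y := by
  simp only [d0]; noncomm_ring

theorem d0_sub (X Y : Op V) : d0 (X - Y) = d0 X - d0 Y := by
  simp only [d0]; noncomm_ring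

theorem d0_add (X Y : Op V) : d0 (X + Y) = d0 X + d0 Y := by
  simp only [d0]; noncomm_ring

theorem d0_smul (c : ℂ) (X : Op V) : d0 (c • X) = c • d0 X := by
  simp only [d0, mul_smul_comm, smul_mul_assoc, smul_sub]

/-- Cyclicity moves one `ε` around the trace, and it anticommutes with `dX`. -/
theorem traceFunctional_conj_eps {X : Op V} (hX : IsTraceClass (d0 X)) (Z : Op V) :
    traceFunctional (d0 X) hX (eps V * Z * eps V) = -traceFunctional (d0 X) hX Z := by
  rw [traceFunctional_apply, traceFunctional_apply, mul_assoc, eps_mul_d0, mul_assoc,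
    opTrace_mul_comm (((hX.mul_right _).neg).mul_left _), ← opTrace_neg (hX.mul_left _)]
  congr 1
  rw [mul_neg, neg_mul, mul_assoc, mul_assoc, eps_mul_eps, mul_one]

theorem traceFunctional_swap {X Y : Op V} (hX : IsTraceClass (d0 X)) (hY : IsTraceClass (d0 Y))
    (a c : Op V) :
    traceFunctional (d0 Y) hY (a * d0 X * c) = traceFunctional (d0 X) hX (c * d0 Y * a) := by
  rw [traceFunctional_apply, traceFunctional_apply]
  have h := opTrace_mul_comm (hY.mul_left c) (a * d0 X)
  have e1 : a * d0 X * c * d0 Y = a * d0 X * (c * d0 Y) := by noncomm_ring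
  have e2 : c * d0 Y * a * d0 X = c * d0 Y * (a * d0 X) := by noncomm_ring
  rw [e1, e2, h]

theorem IsTraceClass.evenPart {Z : Op V} (hZ : IsTraceClass Z) : IsTraceClass (evenPart Z) :=
  hZ.add ((hZ.mul_left _).mul_right _)

theorem Str_eq_opTrace {Z : Op V} (hZ : IsTraceClass Z) : Str Z = opTrace Z := by
  rw [Str, FractionalLoop.evenPart, opTrace_add hZ ((hZ.mul_left _).mul_right _),
    ← opTrace_mul_comm (hZ.mul_left _), ← mul_assoc, eps_mul_eps, one_mul]
  ring

theorem isTraceClass_cocycleForm {X Y : Op V} (hX : IsTraceClass (d0 X))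
    (hY : IsTraceClass (d0 Y)) (p m : ℕ) (B : Op V) : IsTraceClass (cocycleForm p m X Y B) :=
  (((hX.mul_left _).mul_right _).mul_right _).sub (((hY.mul_left _).mul_right _).mul_right _)

theorem IsFlat.eq {B : Op V} (hB : IsFlat B) : eps V * B + B * eps V + B * B = 0 := hB

/-- Cyclicity and `map_conj_comm` bring both halves of each form to words in `X` evaluated by `Tr (·
dY)`. The two halves run through the same sum in opposite order, so the total is `-2 S_p`. -/
theorem cocycle_eq_evenSum {X Y B : Op V} (hX : IsTraceClass (d0 X)) (hY : IsTraceClass (d0 Y))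
    (hB : IsFlat B) (p : ℕ) :
    cocycle p X Y B =
      2 ^ (2 * p + 1) * evenSum (traceFunctional (d0 Y) hY).toLinearMap B X p := by
  have hcomm : ∀ i, eps V * (B * B) ^ i = (B * B) ^ i * eps V := fun i =>
    (sign_mul_sq_comm eps_mul_eps hB.eq).pow_right i
  have hterm : ∀ m ∈ Finset.range (p + 1), Str (cocycleForm p m X Y B) =
      -traceFunctional (d0 Y) hY ((B * B) ^ m * X * (B * B) ^ (p - m))
        - traceFunctional (d0 Y) hY ((B * B) ^ (p - m) * X * (B * B) ^ m) := by
    intro m _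
    have t1 : ∀ {X Y : Op V} (hX : IsTraceClass (d0 X)),
        opTrace (B ^ (2 * m) * d0 X * B ^ (2 * (p - m)) * Y) =
          traceFunctional (d0 X) hX ((B * B) ^ (p - m) * Y * (B * B) ^ m) := by
      intro X Y hX
      rw [traceFunctional_apply, pow_mul, pow_mul, sq, mul_assoc _ _ Y, mul_assoc _ (d0 X),
        opTrace_mul_comm (hX.mul_right _), mul_assoc (d0 X),
        ← opTrace_mul_comm hX]
    have t2 := map_conj_comm (φ := (traceFunctional (d0 Y) hY).toLinearMap)
      (ψ := (traceFunctional (d0 X) hX).toLinearMap) eps_mul_eps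
      (traceFunctional_conj_eps hY) (traceFunctional_conj_eps hX)
      (traceFunctional_swap hX hY) (hcomm m) (hcomm (p - m))
    have i1 : IsTraceClass (B ^ (2 * m) * d0 X * B ^ (2 * (p - m)) * Y) :=
      ((hX.mul_left _).mul_right _).mul_right _
    have i2 : IsTraceClass (B ^ (2 * m) * d0 Y * B ^ (2 * (p - m)) * X) :=
      ((hY.mul_left _).mul_right _).mul_right _
    rw [Str_eq_opTrace (isTraceClass_cocycleForm hX hY p m B), cocycleForm, opTrace_sub i1 i2,
      t1 hX, t1 hY]
    simp only [ContinuousLinearMap.coe_coe] at t2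
    rw [t2, neg_neg]
  have hsum : ∑ m ∈ Finset.range (p + 1),
      traceFunctional (d0 Y) hY ((B * B) ^ (p - m) * X * (B * B) ^ m) =
      evenSum (traceFunctional (d0 Y) hY).toLinearMap B X p := by
    rw [evenSum, ← Finset.sum_range_reflect]
    refine Finset.sum_congr rfl fun m hm => ?_
    have hm' := Finset.mem_range.1 hm
    rw [show p + 1 - 1 - m = p - m by omega, show p - (p - m) = m by omega]
    rfl
  have hsum' : ∑ m ∈ Finset.range (p + 1),
      traceFunctional (d0 Y) hY ((B * B) ^ m * X * (B * B) ^ (p - m)) =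
      evenSum (traceFunctional (d0 Y) hY).toLinearMap B X p := rfl
  rw [cocycle, Finset.sum_congr rfl hterm, Finset.sum_sub_distrib, Finset.sum_neg_distrib, hsum,
    hsum', pow_succ]
  ring

/-- The velocity `dX + [B, X]` is the single commutator `[ε + B, X]`. The parameter is complex here
and is restricted to the reals afterwards. -/
theorem hasDerivAt_gauge (X B : Op V) :
    HasDerivAt (fun z : ℂ => NormedSpace.exp (-(z • X)) * B * NormedSpace.exp (z • X) + z • d0 X)
      ((eps V + B) * X - X * (eps V + B)) 0 := by
  have h1 := hasDerivAt_exp_smul_const X (0 : ℂ)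
  have h2 := hasDerivAt_exp_smul_const (-X) (0 : ℂ)
  have h3 := ((h2.mul_const B).mul h1).add ((hasDerivAt_id (0 : ℂ)).smul_const (d0 X))
  have e : NormedSpace.exp ((0 : ℂ) • -X) * -X * B * NormedSpace.exp ((0 : ℂ) • X) +
        NormedSpace.exp ((0 : ℂ) • -X) * B * (NormedSpace.exp ((0 : ℂ) • X) * X) +
      (1 : ℂ) • d0 X = (eps V + B) * X - X * (eps V + B) := by
    rw [zero_smul, zero_smul, NormedSpace.exp_zero, one_smul, d0]
    noncomm_ring
  rw [e] at h3
  refine h3.congr_of_eventuallyEq (Filter.Eventually.of_forall fun z => ?_)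
  simp

theorem hasDerivAt_gauge_pow (φ : Op V →L[ℂ] ℂ) (X B : Op V) (k : ℕ) :
    HasDerivAt (fun t : ℝ => φ (eps V * (NormedSpace.exp (-(t • X)) * B * NormedSpace.exp (t • X)
        + t • d0 X) ^ (2 * k + 1)))
      (∑ j ∈ Finset.range (2 * k + 1),
        φ (eps V * B ^ j * ((eps V + B) * X - X * (eps V + B)) * B ^ (2 * k - j))) 0 := by
  have h1 := ((hasDerivAt_gauge X B).pow' (2 * k + 1)).const_mul (eps V)
  have h2 := (φ.hasFDerivAt.comp_hasDerivAt (0 : ℂ) h1)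
  have h0 : NormedSpace.exp (-((0 : ℂ) • X)) * B * NormedSpace.exp ((0 : ℂ) • X)
      + (0 : ℂ) • d0 X = B := by
    simp
  have e : φ (eps V * ∑ i ∈ Finset.range (2 * k + 1),
        (NormedSpace.exp (-((0 : ℂ) • X)) * B * NormedSpace.exp ((0 : ℂ) • X)
          + (0 : ℂ) • d0 X) ^ ((2 * k + 1).pred - i) * ((eps V + B) * X - X * (eps V + B)) *
        (NormedSpace.exp (-((0 : ℂ) • X)) * B * NormedSpace.exp ((0 : ℂ) • X)
          + (0 : ℂ) • d0 X) ^ i) = ∑ j ∈ Finset.range (2 * k + 1),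
        φ (eps V * B ^ j * ((eps V + B) * X - X * (eps V + B)) * B ^ (2 * k - j)) := by
    rw [h0, Finset.mul_sum, map_sum, ← Finset.sum_range_reflect]
    refine Finset.sum_congr rfl fun j hj => ?_
    have hj' := Finset.mem_range.1 hj
    rw [Nat.pred_succ, show 2 * k + 1 - 1 - j = 2 * k - j by omega,
      show 2 * k - (2 * k - j) = j by omega, ← mul_assoc, ← mul_assoc]
  rw [e] at h2
  have h3 := h2.comp_ofReal (z := (0 : ℝ))
  simp only [real_smul_op]
  exact h3

/-- The cochain `η_k(Y; B) = Tr (ε B^{2k+1} dY)`. -/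
noncomputable def oddTrace (k : ℕ) (Y B : Op V) : ℂ := opTrace (eps V * B ^ (2 * k + 1) * d0 Y)

theorem gaugeDeriv_sum_oddTrace {Y : Op V} (hY : IsTraceClass (d0 Y)) (X B : Op V) (c : ℕ → ℂ)
    (p : ℕ) :
    gaugeDeriv X (fun B => ∑ k ∈ Finset.range p, c k * oddTrace k Y B) B =
      ∑ k ∈ Finset.range p, c k * ∑ j ∈ Finset.range (2 * k + 1),
        traceFunctional (d0 Y) hY
          (eps V * B ^ j * ((eps V + B) * X - X * (eps V + B)) * B ^ (2 * k - j)) :=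
  (HasDerivAt.fun_sum fun k _ =>
    (hasDerivAt_gauge_pow (traceFunctional (d0 Y) hY) X B k).const_mul (c k)).deriv

/-- The Leibniz rule for `d`, then cyclicity to bring `dX` or `dY` to the right end. -/
theorem oddTrace_lie {X Y : Op V} (hX : IsTraceClass (d0 X)) (hY : IsTraceClass (d0 Y)) (k : ℕ)
    (B : Op V) :
    oddTrace k (X * Y - Y * X) B =
      traceFunctional (d0 X) hX (Y * (eps V * B ^ (2 * k + 1)))
        + traceFunctional (d0 Y) hY (eps V * B ^ (2 * k + 1) * X)
        - traceFunctional (d0 Y) hY (X * (eps V * B ^ (2 * k + 1)))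
        - traceFunctional (d0 X) hX (eps V * B ^ (2 * k + 1) * Y) := by
  simp only [oddTrace, traceFunctional_apply]
  set C := eps V * B ^ (2 * k + 1)
  have e : C * d0 (X * Y - Y * X) =
      C * d0 X * Y + C * X * d0 Y - C * d0 Y * X - C * Y * d0 X := by
    rw [d0_sub, d0_mul, d0_mul]; noncomm_ring
  have i1 := (hX.mul_left C).mul_right Y
  have i2 := hY.mul_left (C * X)
  have i3 := (hY.mul_left C).mul_right X
  have i4 := hX.mul_left (C * Y)
  rw [e, opTrace_sub ((i1.add i2).sub i3) i4, opTrace_sub (i1.add i2) i3, opTrace_add i1 i2,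
    ← opTrace_mul_comm (hX.mul_left C) Y, ← opTrace_mul_comm (hY.mul_left C) X,
    ← mul_assoc Y, ← mul_assoc X]

theorem isTraceClass_d0_loop {𝔤 : LieSubalgebra ℝ (V →L[ℂ] V)} (X : smoothLoops 𝔤) :
    IsTraceClass (d0 (mulOp X.1)) := isTraceClass_d0_mulOp X.2.2

set_option synthInstance.maxHeartbeats 200000 in
/-- The `1`-cochain `∑_{k<p} c_k Tr (ε B^{2k+1} dY)` on smooth loops. -/
noncomputable def oddTraceCochain (𝔤 : LieSubalgebra ℝ (V →L[ℂ] V)) (c : ℕ → ℂ) (p : ℕ) :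
    OneCochain 𝔤 where
  toLinearMap :=
    { toFun := fun Y B => ∑ k ∈ Finset.range p, c k * oddTrace k (mulOp Y.1) B
      map_add' := fun Y Z => by
        funext B
        have h : mulOp (Y + Z).1 = mulOp Y.1 + mulOp Z.1 := mulOp_add _ _
        simp only [Pi.add_apply, ← Finset.sum_add_distrib, ← mul_add, oddTrace, h, d0_add]
        refine Finset.sum_congr rfl fun k _ => ?_
        rw [mul_add, opTrace_add ((isTraceClass_d0_loop Y).mul_left _)
          ((isTraceClass_d0_loop Z).mul_left _)]
      map_smul' := fun r Y => by
        funext B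
        have h : mulOp (r • Y).1 = (r : ℂ) • mulOp Y.1 := mulOp_real_smul _ _
        simp only [Pi.smul_apply, Finset.smul_sum, oddTrace, h, d0_smul, RingHom.id_apply]
        refine Finset.sum_congr rfl fun k _ => ?_
        rw [mul_smul_comm, opTrace_smul ((isTraceClass_d0_loop Y).mul_left _), Complex.real_smul]
        ring }
  smooth := fun Y => by
    have h := (traceFunctional (d0 (mulOp Y.1)) (isTraceClass_d0_loop Y)).contDiff (n := ∞)
    have h2 : ∀ k, ContDiff ℂ ∞ fun B : Op V => eps V * B ^ (2 * k + 1) := fun k =>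
      contDiff_const.mul (contDiff_id.pow _)
    have h3 : ∀ k, ContDiff ℝ ∞ (oddTrace k (mulOp Y.1)) := fun k =>
      (h.comp (h2 k)).restrict_scalars ℝ
    change ContDiff ℝ ∞ fun B => ∑ k ∈ Finset.range p, c k * oddTrace k (mulOp Y.1) B
    exact ContDiff.sum fun k _ => contDiff_const.mul (h3 k)

theorem coboundary_oddTraceCochain {𝔤 : LieSubalgebra ℝ (V →L[ℂ] V)} (c : ℕ → ℂ) (p : ℕ)
    (X Y : smoothLoops 𝔤) {B : Op V} (hB : IsFlat B) :
    coboundary (oddTraceCochain 𝔤 c p) X Y B = ∑ k ∈ Finset.range p, c k *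
      (4 * evenSum (traceFunctional _ (isTraceClass_d0_loop Y)).toLinearMap B (mulOp X.1) k
        - evenSum (traceFunctional _ (isTraceClass_d0_loop Y)).toLinearMap B (mulOp X.1)
          (k + 1)) := by
  have hX := isTraceClass_d0_loop X
  have hY := isTraceClass_d0_loop Y
  have hbr : mulOp (⁅X, Y⁆ : smoothLoops 𝔤).1 =
      mulOp X.1 * mulOp Y.1 - mulOp Y.1 * mulOp X.1 := by
    rw [← mulOp_mul, ← mulOp_mul, ← mulOp_sub]; rfl
  have e : coboundary (oddTraceCochain 𝔤 c p) X Y B =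
      gaugeDeriv (mulOp X.1) (fun B => ∑ k ∈ Finset.range p, c k * oddTrace k (mulOp Y.1) B) B
      - gaugeDeriv (mulOp Y.1) (fun B => ∑ k ∈ Finset.range p, c k * oddTrace k (mulOp X.1) B) B
      - ∑ k ∈ Finset.range p, c k * oddTrace k (mulOp (⁅X, Y⁆ : smoothLoops 𝔤).1) B := rfl
  rw [e, gaugeDeriv_sum_oddTrace hY, gaugeDeriv_sum_oddTrace hX, ← Finset.sum_sub_distrib,
    ← Finset.sum_sub_distrib]
  refine Finset.sum_congr rfl fun k _ => ?_
  rw [hbr, oddTrace_lie hX hY, ← gauge_coboundary_eq eps_mul_eps hB.eq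
    (traceFunctional_conj_eps hY) (traceFunctional_conj_eps hX) (traceFunctional_swap hX hY) k]
  simp only [ContinuousLinearMap.coe_coe]
  ring

theorem centralCocycle_eq_evenSum {X Y : Op V} (hY : IsTraceClass (d0 Y)) (B : Op V) :
    centralCocycle X Y =
      (1 / 2) * evenSum (traceFunctional (d0 Y) hY).toLinearMap B X 0 := by
  simp [centralCocycle, evenSum, traceFunctional_apply]

/-- The weight `4^{p-1-k}` makes the term `-S_{k+1}` cancel against `4 S_{k+1}` at the next index.
-/
theorem sum_geometric_telescope (S : ℕ → ℂ) (p : ℕ) :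
    ∑ k ∈ Finset.range p, (4 : ℂ) ^ (p - 1 - k) * (4 * S k - S (k + 1)) = 4 ^ p * S 0 - S p := by
  induction p with
  | zero => simp
  | succ p ih =>
    have h : ∀ k ∈ Finset.range p, (4 : ℂ) ^ (p + 1 - 1 - k) * (4 * S k - S (k + 1)) =
        4 * ((4 : ℂ) ^ (p - 1 - k) * (4 * S k - S (k + 1))) := by
      intro k hk
      have hk' := Finset.mem_range.1 hk
      rw [show p + 1 - 1 - k = p - 1 - k + 1 by omega, pow_succ]
      ring
    rw [Finset.sum_range_succ, Finset.sum_congr rfl h, ← Finset.mul_sum, ih]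
    simp only [Nat.add_sub_cancel, Nat.sub_self]
    ring

end Cohomology

end FractionalLoop

theorem theorem4p2 {V : Type*} [NormedAddCommGroup V] [InnerProductSpace ℂ V]
    [FiniteDimensional ℂ V] (𝔤 : LieSubalgebra ℝ (V →L[ℂ] V)) (p : ℕ) :
    -- the operators whose traces define the cocycles are trace class
    (∀ (X Y : smoothLoops 𝔤) (B : Op V), IsFlat B → ∀ m ≤ p,
      IsTraceClass (evenPart (cocycleForm p m (mulOp X.1) (mulOp Y.1) B))) ∧
    -- `½ Tr (X dY)` is the cocycle of the standard central extension of the loop algebra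
    (∀ X Y : smoothLoops 𝔤,
      IsTraceClass (mulOp X.1 * d0 (mulOp Y.1)) ∧
      centralCocycle (mulOp X.1) (mulOp Y.1) =
        (2 * Real.pi * Complex.I)⁻¹ * ∫ t in (0 : ℝ)..(2 * Real.pi),
          LinearMap.trace ℂ V
            (X.1 (t : S1) * deriv (fun s : ℝ => Y.1 (s : S1)) t : V →L[ℂ] V)) ∧
    -- `c_p` is cohomologous to it, up to the normalization constant `2 ^ (4p + 2)`
    Cohomologous
      (fun X Y : smoothLoops 𝔤 => fun B => cocycle p (mulOp X.1) (mulOp Y.1) B)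
      (fun X Y _ => (2 : ℂ) ^ (4 * p + 2) * centralCocycle (mulOp X.1) (mulOp Y.1)) := by
  refine ⟨fun X Y B _ m _ => ?_, fun X Y => ⟨?_, ?_⟩, ?_⟩
  · exact (isTraceClass_cocycleForm (isTraceClass_d0_loop X) (isTraceClass_d0_loop Y) p m B).evenPart
  · exact (isTraceClass_d0_loop Y).mul_left _
  · exact opTrace_mulOp_mul_d0 X.1 Y.2.2
  -- The weights are forced by `c_p - 2^{4p+2} c = 2^{2p+1} (S_p - 4^p S_0)`, which is `-2^{2p+1}`
  -- times the telescoped sum. For `p = 0` the cochain is zero and the identity is exact.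
  · refine ⟨oddTraceCochain 𝔤 (fun k => -2 ^ (2 * p + 1) * 4 ^ (p - 1 - k)) p, fun X Y B hB => ?_⟩
    have hY := isTraceClass_d0_loop Y
    have h := sum_geometric_telescope
      (evenSum (traceFunctional _ hY).toLinearMap B (mulOp X.1)) p
    beta_reduce
    rw [coboundary_oddTraceCochain _ _ _ _ hB,
      cocycle_eq_evenSum (isTraceClass_d0_loop X) hY hB, centralCocycle_eq_evenSum hY B]
    simp only [mul_assoc]
    rw [← Finset.mul_sum, h, show 4 * p + 2 = 2 * p + 1 + 2 * p + 1 by ring, pow_succ _ (_ + _),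
      pow_add _ _ (2 * p), pow_mul 2 2 p]
    norm_num
    ring
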